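/- Let $R$ be a commutative noetherian local ring with maximal ideal $\mathfrak m$ and residue field $k=R/\mathfrak m$, such that $\mathfrak m^3=0\neq\mathfrak m^2$, and assume that $R$ is not Gorenstein (that is, $R$ does not have finite injective dimension as an $R$-module). Put $$a=\operatorname{rank}_k \mathfrak m^2,\qquad e=\operatorname{rank}_k \mathfrak m/\mathfrak m^2,\qquad r=\operatorname{rank}_k \operatorname{Soc} R,$$ where $\operatorname{Soc}R=\{x\in R\mid \mathfrak m x=0\}$. For a finitely generated $R$-module $M$ let $\beta_i(M)=\operatorname{rank}_k\operatorname{Ext}^i_R(M,k)$ denote its $i$-th Betti number, let $M_0=M$, and for $i\ge 1$ let $M_i$ denote the $i$-th syzygy in a minimal free resolution of $M$. Let $M$ be a finitely generated $R$-module with $\beta_1(M)>\beta_0(M)$. Then the following hold. (a) If $a\neq e$ or $a\neq r$, then the sequence $(\beta_i(M))_{i\ge 0}$ is strictly increasing and has termwise exponential growth, i.e. there is a real number $A>1$ such that $\beta_{i+1}(M)\ge A\,\beta_i(M)$ for all sufficiently large $i$. (b) If $a=e=r$, then the sequence $(\beta_i(M))_{i\ge 0}$ is non-decreasing, and $\beta_i(M)>\beta_{i-1}(M)$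 holds for all $i\ge 1$ except possibly one. Moreover, if $\beta_j(M)=\beta_{j-1}(M)$ for some $j\ge 1$, then $j\ge 2$, and $k$ is a direct summand of $M_{j+1}$ but not a direct summand of $M_i$ for any $0\le i\le j$. -/

import Mathlib

open CategoryTheory IsLocalRing Filter

universe u

namespace LocalRingBetti

/-- The rank over the residue field `k = R/𝔪` of an `R`-module `V` that is annihilated by `𝔪`,
where `V` carries its induced structure of a `k`-vector space. -/
noncomputable def residueRank {R : Type u} [CommRing R] [IsLocalRing R]
    {V : Type*} [AddCommGroup V] [Module R V]
    (hV : Module.IsTorsionBySet R V (maximalIdeal R)) : ℕ :=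
  letI : Module (ResidueField R) V := hV.module
  Module.finrank (ResidueField R) V

/-- The maximal ideal annihilates `Ext^i_R(M, k)`. -/
theorem isTorsionBySet_ext (R : Type u) [CommRing R] [IsLocalRing R]
    (M : Type u) [AddCommGroup M] [Module R M] (i : ℕ) :
    Module.IsTorsionBySet R
      (Abelian.Ext (ModuleCat.of R M) (ModuleCat.of R (ResidueField R)) i) (maximalIdeal R) := by
  rintro x ⟨r, hr⟩
  have h0 : r • (𝟙 (ModuleCat.of R (ResidueField R))) = 0 := by
    ext y
    change r • y = 0
    rw [Algebra.smul_def, ResidueField.algebraMap_eq, (residue_eq_zero_iff r).2 hr, zero_mul]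
  change r • x = 0
  rw [← Abelian.Ext.comp_mk₀_id x, ← Abelian.Ext.comp_smul, ← Abelian.Ext.mk₀_smul, h0,
    Abelian.Ext.mk₀_zero, Abelian.Ext.comp_zero]

/-- The `i`-th Betti number `β_i(M) = rank_k Ext^i_R(M, k)`. -/
noncomputable def betti (R : Type u) [CommRing R] [IsLocalRing R]
    (M : Type u) [AddCommGroup M] [Module R M] (i : ℕ) : ℕ :=
  residueRank (isTorsionBySet_ext R M i)

/-- A (noetherian) local ring is Gorenstein if it has finite injective dimension as a module
over itself. -/
def IsGorensteinLocal (R : Type u) [CommRing R] [IsLocalRing R] : Prop :=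
  IsNoetherianRing R ∧ ∃ n : ℕ, HasInjectiveDimensionLE (ModuleCat.of R R) n

/-- The embedding dimension: the rank of the `k`-vector space `𝔪/𝔪²`. -/
noncomputable def embDim (R : Type u) [CommRing R] [IsLocalRing R] : ℕ :=
  Module.finrank (ResidueField R) (CotangentSpace R)

/-- The socle `Soc R = {x | 𝔪 x = 0}`. -/
def socle (R : Type u) [CommRing R] [IsLocalRing R] : Submodule R R :=
  Submodule.torsionBySet R R (maximalIdeal R)

/-- The socle rank: the rank of the `k`-vector space `Soc R`. -/
noncomputable def socleRank (R : Type u) [CommRing R] [IsLocalRing R] : ℕ :=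
  residueRank (R := R) (V := socle R)
    (Submodule.torsionBySet_isTorsionBySet (maximalIdeal R : Set R))

/-- If `𝔪³ = 0`, then `𝔪` annihilates `𝔪²`. -/
theorem isTorsionBySet_sq {R : Type u} [CommRing R] [IsLocalRing R]
    (h3 : maximalIdeal R ^ 3 = ⊥) :
    Module.IsTorsionBySet R (maximalIdeal R ^ 2 : Ideal R) (maximalIdeal R) := by
  rintro ⟨x, hx⟩ ⟨r, hr⟩
  have h : r * x ∈ maximalIdeal R ^ 3 := by
    rw [pow_succ' (maximalIdeal R) 2]
    exact Ideal.mul_mem_mul hr hx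
  rw [h3] at h
  exact Subtype.ext h

/-- The residue field `k` is (isomorphic to) a direct summand of `N`. -/
def HasResidueSummand (R : Type u) [CommRing R] [IsLocalRing R]
    (N : Type*) [AddCommGroup N] [Module R N] : Prop :=
  ∃ P Q : Submodule R N, IsCompl P Q ∧ Nonempty (P ≃ₗ[R] ResidueField R)

/-- A minimal free resolution `⋯ → R^{n₂} → R^{n₁} → R^{n₀} → M → 0` of a module over a local
ring, by finitely generated free modules. -/
structure MinimalFreeResolution (R : Type u) [CommRing R] [IsLocalRing R]
    (M : Type u) [AddCommGroup M] [Module R M] where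
  /-- the ranks of the free modules -/
  rank : ℕ → ℕ
  /-- the augmentation -/
  aug : (Fin (rank 0) → R) →ₗ[R] M
  /-- the differentials -/
  d : ∀ i : ℕ, (Fin (rank (i + 1)) → R) →ₗ[R] (Fin (rank i) → R)
  aug_surjective : Function.Surjective aug
  exact_zero : LinearMap.range (d 0) = LinearMap.ker aug
  exact_succ : ∀ i : ℕ, LinearMap.range (d (i + 1)) = LinearMap.ker (d i)
  minimal : ∀ i : ℕ, LinearMap.range (d i) ≤ maximalIdeal R • ⊤

/-- The residue field is a direct summand of the `i`-th syzygy `M_i` in the given minimal free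
resolution of `M`, where `M_0 = M` and `M_{i+1}` is the image of the differential
`R^{n_{i+1}} → R^{n_i}`. -/
def MinimalFreeResolution.ResidueSummandOfSyzygy {R : Type u} [CommRing R] [IsLocalRing R]
    {M : Type u} [AddCommGroup M] [Module R M] (F : MinimalFreeResolution R M) : ℕ → Prop
  | 0 => HasResidueSummand R M
  | i + 1 => HasResidueSummand R (LinearMap.range (F.d i))

/-- Termwise exponential growth: there is a real number `A > 1` with `b_{i+1} ≥ A b_i` for all
sufficiently large `i`. -/
def TermwiseExponentialGrowth (b : ℕ → ℕ) : Prop :=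
  ∃ A : ℝ, 1 < A ∧ ∀ᶠ i in atTop, A * (b i : ℝ) ≤ (b (i + 1) : ℝ)

/-- Every finitely generated module has a minimal free cover. -/
theorem exists_minimal_free_cover {R : Type u} [CommRing R] [IsLocalRing R] (N : Type u) [AddCommGroup N] [Module R N]
    [Module.Finite R N] : ∃ (n : ℕ) (f : (Fin n → R) →ₗ[R] N), Function.Surjective f ∧
      LinearMap.ker f ≤ maximalIdeal R • ⊤ := by
  classical
  let k := ResidueField R
  let b := Module.finBasis k (TensorProduct R k N)
  have hs : Function.Surjective (TensorProduct.mk R k N 1) :=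
    TensorProduct.mk_surjective R N k residue_surjective
  choose v hv using fun i => hs (b i)
  refine ⟨_, Fintype.linearCombination R v, ?_, ?_⟩
  · rw [← LinearMap.range_eq_top, Fintype.range_linearCombination]
    exact IsLocalRing.span_eq_top_of_tmul_eq_basis v b hv
  · intro x hx
    have h1 : ∑ i, x i • v i = 0 := by simpa [Fintype.linearCombination_apply] using hx
    have h2 : ∑ i, (residue R (x i)) • b i = 0 := by
      have := congrArg (TensorProduct.mk R k N 1) h1
      simp only [map_sum, map_smul, hv, map_zero] at this
      rw [← this]
      refine Finset.sum_congr rfl fun i _ => ?_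
      exact algebraMap_smul (ResidueField R) (x i) (b i)
    have h3 := Fintype.linearIndependent_iff.1 b.linearIndependent _ h2
    have : x = ∑ i, x i • (Pi.single i (1:R) : _ → R) := by
      ext j; simp [Finset.sum_apply, Pi.single_apply]
    rw [this]
    exact Submodule.sum_mem _ fun i _ => Submodule.smul_mem_smul ((residue_eq_zero_iff _).1 (h3 i)) trivial

/-- Minimal free resolutions exist, so quantifying over all of them is not vacuous. -/
theorem nonempty_minimalFreeResolution {R : Type u} [CommRing R] [IsLocalRing R]
    [IsNoetherianRing R] (M : Type u) [AddCommGroup M] [Module R M] [Module.Finite R M] :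
    Nonempty (MinimalFreeResolution R M) := by
  obtain ⟨n, f, hf, hk⟩ := exists_minimal_free_cover (R := R) M
  have step : ∀ (m : ℕ) (K : Submodule R (Fin m → R)),
    ∃ (n : ℕ) (g : (Fin n → R) →ₗ[R] (Fin m → R)), LinearMap.range g = K ∧
      LinearMap.ker g ≤ maximalIdeal R • ⊤ := by
    intro m K
    obtain ⟨n, g, hg, hk⟩ := exists_minimal_free_cover (R := R) K
    refine ⟨n, K.subtype ∘ₗ g, ?_, ?_⟩
    · rw [LinearMap.range_comp, LinearMap.range_eq_top.2 hg]; simp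
    · rwa [LinearMap.ker_comp_of_ker_eq_bot _ K.ker_subtype]
  choose N G hG1 hG2 using step
  let S : ℕ → Σ m : ℕ, {K : Submodule R (Fin m → R) // K ≤ maximalIdeal R • ⊤} := fun i =>
    Nat.rec ⟨n, LinearMap.ker f, hk⟩ (fun _ p => ⟨N p.1 p.2.1, LinearMap.ker (G p.1 p.2.1), hG2 _ _⟩) i
  exact ⟨{
    rank := fun i => (S i).1
    aug := f
    d := fun i => G (S i).1 (S i).2.1
    aug_surjective := hf
    exact_zero := hG1 _ _
    exact_succ := fun i => hG1 _ _
    minimal := fun i => (hG1 _ _).le.trans (S i).2.2 }⟩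
end LocalRingBetti

/-! Since `𝔪³ = 0`, `R` is artinian and the argument is a count of lengths. Put `b i = β_i(M)` and
let `s i` be the length of `𝔪 M_i`. As `M_{i+1}` is the kernel of `R^{b i} → M_i` and lies in `𝔪
R^{b i}`, one has `b (i+1) + s (i+1) + s i = b i (e + a)` and `s (i+1) ≤ a b i`. For `i ≥ 1` the
socle kills `M_i`, so `Soc R · R^{b i}` lies in `M_{i+1}`; it contains `𝔪 M_{i+1}`, whence `s (i+1)
≤ e (length M_{i+1} - r b i)`. These `SyzygyRelations` imply a second-order recurrence
(`linear_bound`) and a bound for consecutive ratios (`ratio_bound`). Failure of the Gorenstein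
property enters only as `r ≥ 2`.

Part (a) is then arithmetic: the ratio bound exceeds 1 unless `a = r ≤ e`, and for `a = r < e` the
recurrence propagates the growth from `b 0 < b 1`.

In part (b) the ratio bound gives monotonicity from index 1 on, and `b j = b (j-1)` forces `s j = e
b j`, the largest value possible. A summand `k` of `M_j` would lower `s j`. A summand `k` of an
earlier `M_i` would pass the extremal equality to the resolution of `k`, making its Betti numbers
fail to increase, against `rank_residueField_lt`. The sum relation leaves `s (j+1) < e b j`, so `𝔪
M_{j+1}` misses part of `𝔪² R^{b j}`, and this splits `k` off `M_{j+1}`. A second repetition would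
contradict the absence of earlier summands. -/

namespace LocalRingBetti

/-! ### Lengths as natural numbers -/

section Length

variable {R : Type u} [CommRing R]

/-- The length of a module as a natural number. -/
noncomputable def len (R : Type u) [CommRing R] (N : Type*) [AddCommGroup N] [Module R N] : ℕ :=
  (Module.length R N).toNat

theorem residueRank_eq_len [IsLocalRing R] {V : Type*} [AddCommGroup V] [Module R V]
    (hV : Module.IsTorsionBySet R V (maximalIdeal R)) : residueRank hV = len R V := by
  let : Module (ResidueField R) V := hV.module
  have : IsScalarTower R (ResidueField R) V := hV.isScalarTower
  have h1 : Module.length R V = Module.length (ResidueField R) V :=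
    Module.length_eq_of_surjective residue_surjective
  -- `finrank` and `len` both take the value 0 in infinite rank, so no finiteness is needed.
  rw [len, h1, Module.length_eq_rank]
  rfl

theorem len_congr {N P : Type*} [AddCommGroup N] [Module R N] [AddCommGroup P] [Module R P]
    (e : N ≃ₗ[R] P) : len R N = len R P := by
  rw [len, len, e.length_eq]

theorem len_comap_subtype {M : Type*} [AddCommGroup M] [Module R M] {p q : Submodule R M} (h : p ≤ q) :
    len R (p.comap q.subtype) = len R p :=
  len_congr (Submodule.comapSubtypeEquivOfLe h)

theorem len_eq_add_of_exact {N M P : Type*} [AddCommGroup N] [Module R N] [AddCommGroup M]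
    [Module R M] [AddCommGroup P] [Module R P] [IsArtinian R M] [IsNoetherian R M]
    (f : N →ₗ[R] M) (g : M →ₗ[R] P) (hf : Function.Injective f) (hg : Function.Surjective g)
    (H : Function.Exact f g) : len R M = len R N + len R P := by
  have h := Module.length_eq_add_of_exact f g hf hg H
  have hM : Module.length R M ≠ ⊤ := Module.length_ne_top
  have hN : Module.length R N ≠ ⊤ :=
    ((Module.length_le_of_injective f hf).trans_lt hM.lt_top).ne
  have hP : Module.length R P ≠ ⊤ :=
    ((Module.length_le_of_surjective g hg).trans_lt hM.lt_top).ne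
  rw [len, len, len, h, ENat.toNat_add hN hP]

section

variable {M : Type*} [AddCommGroup M] [Module R M] [IsArtinian R M] [IsNoetherian R M]

theorem len_submodule_add_quotient (p : Submodule R M) :
    len R p + len R (M ⧸ p) = len R M :=
  (len_eq_add_of_exact p.subtype p.mkQ p.injective_subtype p.mkQ_surjective
    (LinearMap.exact_subtype_mkQ p)).symm

theorem len_ker_add_range {P : Type*} [AddCommGroup P] [Module R P] (f : M →ₗ[R] P) :
    len R (LinearMap.ker f) + len R (LinearMap.range f) = len R M := by
  rw [← len_congr f.quotKerEquivRange, len_submodule_add_quotient]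

theorem len_ker_add_of_surjective {P : Type*} [AddCommGroup P] [Module R P] (f : M →ₗ[R] P)
    (hf : Function.Surjective f) : len R (LinearMap.ker f) + len R P = len R M := by
  rw [← len_congr (f.quotKerEquivOfSurjective hf), len_submodule_add_quotient]

theorem len_submodule_lt {p q : Submodule R M} (h : p < q) : len R p < len R q := by
  have h1 : Module.length R p < Module.length R q := by
    rw [Module.length_submodule, Module.length_submodule]
    exact Submodule.height_strictMono h
  have hq : Module.length R q ≠ ⊤ := Module.length_ne_top
  have hp : Module.length R p ≠ ⊤ := Module.length_ne_top
  rw [len, len, ← Nat.cast_lt (α := ℕ∞), ENat.natCast_toNat hp, ENat.natCast_toNat hq]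
  exact h1

theorem len_submodule_mono {p q : Submodule R M} (h : p ≤ q) : len R p ≤ len R q := by
  rcases h.eq_or_lt with rfl | h
  · rfl
  · exact (len_submodule_lt h).le

theorem len_fun (n : ℕ) : len R (Fin n → M) = n * len R M := by
  have hM : Module.length R M ≠ ⊤ := Module.length_ne_top
  rw [len, len, Module.length_pi]
  simp

theorem len_prod {P : Type*} [AddCommGroup P] [Module R P] [IsArtinian R P] [IsNoetherian R P] :
    len R (M × P) = len R M + len R P := by
  rw [len, len, len, Module.length_prod,
    ENat.toNat_add Module.length_ne_top Module.length_ne_top]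

theorem len_pos [Nontrivial M] : 0 < len R M := by
  have h : Module.length R M ≠ ⊤ := Module.length_ne_top
  have h' : Module.length R M ≠ 0 := Module.length_pos.ne'
  exact Nat.pos_of_ne_zero fun h0 => (ENat.toNat_eq_zero.1 h0).elim h' h

end

theorem len_residueField [IsLocalRing R] : len R (ResidueField R) = 1 := by
  have : Module.length R (ResidueField R) = Module.length (ResidueField R) (ResidueField R) :=
    Module.length_eq_of_surjective residue_surjective
  rw [len, this, Module.length_eq_one]
  rfl

end Length

/-! ### Betti numbers from minimal covers -/

section Ext

open Abelian

variable {R : Type u} [CommRing R] [IsLocalRing R]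

theorem betti_eq_len (M : Type u) [AddCommGroup M] [Module R M] (i : ℕ) :
    betti R M i = len R (Ext (ModuleCat.of R M) (ModuleCat.of R (ResidueField R)) i) :=
  residueRank_eq_len _

theorem apply_eq_zero_of_mem_smul_top {N : Type*} [AddCommGroup N] [Module R N]
    (h : N →ₗ[R] ResidueField R) {x : N} (hx : x ∈ maximalIdeal R • (⊤ : Submodule R N)) :
    h x = 0 := by
  refine Submodule.smul_induction_on hx (fun r hr n _ => ?_) (fun x y hx hy => ?_)
  · rw [map_smul, Algebra.smul_def, ResidueField.algebraMap_eq, (residue_eq_zero_iff r).2 hr,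
      zero_mul]
  · rw [map_add, hx, hy, add_zero]

theorem exists_comp_eq_of_cover {F M : Type*} [AddCommGroup F] [Module R F] [AddCommGroup M]
    [Module R M] (f : F →ₗ[R] M) (hf : Function.Surjective f)
    (hk : LinearMap.ker f ≤ maximalIdeal R • ⊤) (h : F →ₗ[R] ResidueField R) :
    ∃ g : M →ₗ[R] ResidueField R, g ∘ₗ f = h := by
  have hle : LinearMap.ker f ≤ LinearMap.ker h := fun x hx =>
    apply_eq_zero_of_mem_smul_top h (hk hx)
  refine ⟨(LinearMap.ker f).liftQ h hle ∘ₗ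
    (f.quotKerEquivOfSurjective hf).symm.toLinearMap, LinearMap.ext fun x => ?_⟩
  have : (f.quotKerEquivOfSurjective hf).symm (f x) = Submodule.Quotient.mk x := by
    rw [LinearEquiv.symm_apply_eq]; rfl
  change (LinearMap.ker f).liftQ h hle ((f.quotKerEquivOfSurjective hf).symm (f x)) = h x
  rw [this]
  rfl

theorem betti_zero_of_cover {M : Type u} [AddCommGroup M] [Module R M] {n : ℕ}
    (f : (Fin n → R) →ₗ[R] M) (hf : Function.Surjective f)
    (hk : LinearMap.ker f ≤ maximalIdeal R • ⊤) [IsNoetherianRing R] [IsArtinianRing R] :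
    betti R M 0 = n := by
  let e0 : Ext (ModuleCat.of R M) (ModuleCat.of R (ResidueField R)) 0 ≃ₗ[R]
      (M →ₗ[R] ResidueField R) := Ext.linearEquiv₀.trans ModuleCat.homLinearEquiv
  let φ : (M →ₗ[R] ResidueField R) →ₗ[R] ((Fin n → R) →ₗ[R] ResidueField R) :=
    LinearMap.lcomp R (ResidueField R) f
  have hφ : Function.Bijective φ := by
    constructor
    · intro g g' h
      ext x
      obtain ⟨y, rfl⟩ := hf x
      exact LinearMap.congr_fun h y
    · intro h
      obtain ⟨g, hg⟩ := exists_comp_eq_of_cover f hf hk h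
      exact ⟨g, hg⟩
  let e1 : ((Fin n → R) →ₗ[R] ResidueField R) ≃ₗ[R] (Fin n → ResidueField R) :=
    LinearEquiv.piRing R (ResidueField R) (Fin n) R
  rw [betti_eq_len, len_congr e0, len_congr (LinearEquiv.ofBijective φ hφ), len_congr e1, len_fun,
    len_residueField, mul_one]

/-- The connecting map of the cover is bijective. In degree 0 injectivity uses minimality: maps from
the free module to `k` vanish on a kernel contained in `𝔪 F`. -/
theorem betti_succ_of_cover {M : Type u} [AddCommGroup M] [Module R M] {n : ℕ}
    (f : (Fin n → R) →ₗ[R] M) (hf : Function.Surjective f)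
    (hk : LinearMap.ker f ≤ maximalIdeal R • ⊤) (i : ℕ) :
    betti R M (i + 1) = betti R (LinearMap.ker f) i := by
  let exac := LinearMap.shortExact_shortComplexKer hf
  let K := ModuleCat.of R (ResidueField R)
  let δ := exac.extClass.precompOfLinear R K (add_comm 1 i)
  have : Projective (f.shortComplexKer).X₂ := inferInstanceAs
    (Projective (ModuleCat.of R (Fin n → R)))
  have hδ : Function.Bijective δ := by
    refine ⟨?_, precomp_extClass_surjective_of_projective_X₂ K exac i⟩
    rw [← LinearMap.ker_eq_bot, LinearMap.ker_eq_bot']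
    intro x hx
    obtain ⟨y, hy⟩ := Ext.contravariant_sequence_exact₁ exac K x (add_comm 1 i) hx
    cases i with
    | succ i => rw [← hy, Ext.eq_zero_of_projective y, Ext.comp_zero]
    | zero =>
      obtain ⟨h, rfl⟩ := Ext.homEquiv₀.symm.surjective y
      rw [← hy]
      have : (f.shortComplexKer).f ≫ h = 0 := by
        ext z
        exact apply_eq_zero_of_mem_smul_top h.hom (hk z.2)
      change (Ext.mk₀ _).comp (Ext.mk₀ h) _ = 0
      rw [Ext.mk₀_comp_mk₀, this, Ext.mk₀_zero]
  rw [betti_eq_len, betti_eq_len]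
  exact (len_congr (LinearEquiv.ofBijective δ hδ)).symm

theorem betti_congr {M N : Type u} [AddCommGroup M] [Module R M] [AddCommGroup N] [Module R N]
    (e : M ≃ₗ[R] N) (i : ℕ) : betti R M i = betti R N i := by
  rw [betti_eq_len, betti_eq_len]
  let e' : ModuleCat.of R M ≅ ModuleCat.of R N := e.toModuleIso
  let K := ModuleCat.of R (ResidueField R)
  refine (len_congr (LinearEquiv.ofBijective
    ((Ext.mk₀ e'.hom).precompOfLinear R K (zero_add i)) ?_)).symm
  refine Function.bijective_iff_has_inverse.2
    ⟨(Ext.mk₀ e'.inv).precompOfLinear R K (zero_add i), fun x => ?_, fun x => ?_⟩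
  all_goals simp [← Ext.comp_assoc_of_second_deg_zero]

theorem betti_prod [IsNoetherianRing R] [IsArtinianRing R]
    (M N : Type u) [AddCommGroup M] [Module R M] [Module.Finite R M]
    [AddCommGroup N] [Module R N] [Module.Finite R N] (i : ℕ) :
    betti R (M × N) i = betti R M i + betti R N i := by
  rw [betti_eq_len, betti_eq_len, betti_eq_len]
  let K := ModuleCat.of R (ResidueField R)
  let ι₁ : ModuleCat.of R M ⟶ ModuleCat.of R (M × N) := ModuleCat.ofHom (LinearMap.inl R M N)
  let ι₂ : ModuleCat.of R N ⟶ ModuleCat.of R (M × N) := ModuleCat.ofHom (LinearMap.inr R M N)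
  let π₁ : ModuleCat.of R (M × N) ⟶ ModuleCat.of R M := ModuleCat.ofHom (LinearMap.fst R M N)
  let π₂ : ModuleCat.of R (M × N) ⟶ ModuleCat.of R N := ModuleCat.ofHom (LinearMap.snd R M N)
  have h11 : ι₁ ≫ π₁ = 𝟙 _ := by ext x; rfl
  have h22 : ι₂ ≫ π₂ = 𝟙 _ := by ext x; rfl
  have h12 : ι₁ ≫ π₂ = 0 := by ext x; rfl
  have h21 : ι₂ ≫ π₁ = 0 := by ext x; rfl
  have hs : π₁ ≫ ι₁ + π₂ ≫ ι₂ = 𝟙 _ := by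
    refine ModuleCat.hom_ext (LinearMap.ext fun x => Prod.ext ?_ ?_)
    · exact add_zero x.1
    · exact zero_add x.2
  refine len_eq_add_of_exact ((Ext.mk₀ π₁).precompOfLinear R K (zero_add i))
    ((Ext.mk₀ ι₂).precompOfLinear R K (zero_add i)) ?_ ?_ ?_
  · refine Function.LeftInverse.injective (g := (Ext.mk₀ ι₁).precompOfLinear R K (zero_add i)) ?_
    intro x
    simp [h11]
  · refine Function.RightInverse.surjective
      (g := (Ext.mk₀ π₂).precompOfLinear R K (zero_add i)) ?_
    intro x
    simp [h22]
  · intro x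
    constructor
    · intro hx
      refine ⟨(Ext.mk₀ ι₁).precompOfLinear R K (zero_add i) x, ?_⟩
      have hx' : (Ext.mk₀ ι₂).comp x (zero_add i) = 0 := hx
      have : x = (Ext.mk₀ (π₁ ≫ ι₁ + π₂ ≫ ι₂)).comp x (zero_add i) := by rw [hs]; simp
      conv_rhs => rw [this]
      rw [Ext.mk₀_add, Ext.add_comp, ← Ext.mk₀_comp_mk₀_assoc, ← Ext.mk₀_comp_mk₀_assoc, hx']
      simp
    · rintro ⟨y, rfl⟩
      simp [h21]

end Ext

/-! ### Length counts over a local ring -/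

section Rings

variable {R : Type u} [CommRing R]

theorem mem_smul_top_fun {n : ℕ} (I : Ideal R) {x : Fin n → R} :
    x ∈ I • (⊤ : Submodule R (Fin n → R)) ↔ ∀ i, x i ∈ I := by
  constructor
  · intro hx i
    refine Submodule.smul_induction_on hx (fun r hr y _ => ?_) (fun x y hx hy => ?_)
    · exact I.mul_mem_right _ hr
    · exact I.add_mem hx hy
  · intro hx
    have : x = ∑ i, x i • (Pi.single i (1 : R) : Fin n → R) := by
      ext j; simp [Finset.sum_apply, Pi.single_apply]
    rw [this]
    exact Submodule.sum_mem _ fun i _ => Submodule.smul_mem_smul (hx i) trivial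

theorem len_smul_top_fun [IsArtinianRing R] [IsNoetherianRing R] (n : ℕ) (I : Ideal R) :
    len R (I • ⊤ : Submodule R (Fin n → R)) = n * len R I := by
  have h : LinearMap.range (I.subtype.compLeft (Fin n)) =
      (I • ⊤ : Submodule R (Fin n → R)) := by
    ext x
    rw [mem_smul_top_fun]
    constructor
    · rintro ⟨y, rfl⟩ i
      exact (y i).2
    · intro hx
      exact ⟨fun i => ⟨x i, hx i⟩, rfl⟩
  have hinj : Function.Injective (I.subtype.compLeft (Fin n)) := fun y z hyz =>
    funext fun i => Subtype.ext (congrFun hyz i)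
  rw [← len_fun (M := I) n, ← h]
  exact (len_congr (LinearEquiv.ofInjective _ hinj)).symm

theorem len_add_len_ker_of_cover [IsArtinianRing R] [IsNoetherianRing R]
    {N : Type*} [AddCommGroup N] [Module R N] {n : ℕ} (f : (Fin n → R) →ₗ[R] N)
    (hf : Function.Surjective f) :
    len R N + len R (LinearMap.ker f) = n * len R R := by
  rw [add_comm, len_ker_add_of_surjective f hf, len_fun]

variable [IsLocalRing R]

/-- The length of `𝔪 N`. -/
noncomputable def radLen (R : Type u) [CommRing R] [IsLocalRing R]
    (N : Type*) [AddCommGroup N] [Module R N] : ℕ :=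
  len R (maximalIdeal R • ⊤ : Submodule R N)

theorem radLen_submodule {N : Type*} [AddCommGroup N] [Module R N] (X : Submodule R N) :
    radLen R X = len R (maximalIdeal R • X : Submodule R N) := by
  have h : (maximalIdeal R • ⊤ : Submodule R X).map X.subtype = maximalIdeal R • X := by
    rw [Submodule.map_smul'', Submodule.map_subtype_top]
  rw [radLen, ← h]
  exact len_congr (Submodule.equivMapOfInjective _ X.injective_subtype _)

theorem len_maximalIdeal [IsArtinianRing R] [IsNoetherianRing R] :
    len R (maximalIdeal R) = embDim R + len R (maximalIdeal R ^ 2 : Ideal R) := by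
  have h1 : embDim R = len R (CotangentSpace R) := by
    have : Module.length R (CotangentSpace R) =
        Module.length (ResidueField R) (CotangentSpace R) :=
      Module.length_eq_of_surjective residue_surjective
    rw [len, this, Module.length_eq_rank]
    rfl
  have h2 : len R (maximalIdeal R ^ 2 : Ideal R) = radLen R (maximalIdeal R) := by
    rw [radLen_submodule, smul_eq_mul, sq]
  rw [h1, h2, add_comm]
  exact (len_submodule_add_quotient (maximalIdeal R • ⊤ : Submodule R (maximalIdeal R))).symm

theorem embDim_pos [IsArtinianRing R] [IsNoetherianRing R] (h3 : maximalIdeal R ^ 3 = ⊥)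
    (h2 : maximalIdeal R ^ 2 ≠ ⊥) : 0 < embDim R := by
  have hne : maximalIdeal R ^ 2 ≠ maximalIdeal R := by
    intro h
    apply h2
    rw [← h3, pow_succ (maximalIdeal R) 2, h, ← sq, h]
  have := len_submodule_lt (lt_of_le_of_ne (Ideal.pow_le_self two_ne_zero) hne)
  rw [len_maximalIdeal] at this
  omega

theorem len_self [IsArtinianRing R] [IsNoetherianRing R] :
    len R R = 1 + len R (maximalIdeal R) := by
  rw [← len_submodule_add_quotient (M := R) (maximalIdeal R), add_comm]
  congr 1
  exact len_residueField

theorem isArtinianRing_of_pow_eq_bot [IsNoetherianRing R] {n : ℕ}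
    (h : maximalIdeal R ^ n = ⊥) : IsArtinianRing R :=
  isArtinianRing_iff_isNilpotent_maximalIdeal R |>.2 ⟨n, h⟩

/-- An element outside `𝔪 N` has a unit coordinate in a minimal cover, so some map `N → k` is
nonzero on it. Being killed by `𝔪`, it spans a copy of `k` on which that map is an isomorphism. -/
theorem exists_residueSummand {N : Type u} [AddCommGroup N] [Module R N] [Module.Finite R N]
    {x : N} (hx : ∀ r ∈ maximalIdeal R, r • x = 0)
    (hxm : x ∉ (maximalIdeal R • ⊤ : Submodule R N)) : HasResidueSummand R N := by
  obtain ⟨n, f, hf, hk⟩ := exists_minimal_free_cover (R := R) N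
  obtain ⟨c, rfl⟩ := hf x
  have hc : ∃ i, c i ∉ maximalIdeal R := by
    by_contra! h
    apply hxm
    rw [← LinearMap.range_eq_top.2 hf, ← Submodule.map_top, ← Submodule.map_smul'']
    exact ⟨c, (mem_smul_top_fun _).2 h, rfl⟩
  obtain ⟨i, hi⟩ := hc
  obtain ⟨g, hg⟩ := exists_comp_eq_of_cover f hf hk
    ((Algebra.linearMap R (ResidueField R)) ∘ₗ LinearMap.proj i)
  have hgx : g (f c) ≠ 0 := by
    have : g (f c) = residue R (c i) := LinearMap.congr_fun hg c
    rw [this, Ne, residue_eq_zero_iff]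
    exact hi
  have hsmul : ∀ (r : R) (y : N), g (r • y) = residue R r * g y := fun r y => by
    rw [map_smul, Algebra.smul_def]; rfl
  have hdis : ∀ y ∈ R ∙ f c, g y = 0 → y = 0 := by
    intro y hy hgy
    obtain ⟨r, rfl⟩ := Submodule.mem_span_singleton.1 hy
    rw [hsmul, mul_eq_zero, or_iff_left hgx, residue_eq_zero_iff] at hgy
    exact hx r hgy
  have hsur : ∀ z : ResidueField R, ∃ r : R, g (r • f c) = z := by
    intro z
    obtain ⟨r, hr⟩ := residue_surjective (z / g (f c))
    exact ⟨r, by rw [hsmul, hr, div_mul_cancel₀ _ hgx]⟩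
  refine ⟨R ∙ f c, LinearMap.ker g, ⟨?_, ?_⟩, ⟨LinearEquiv.ofBijective (g.domRestrict _) ?_⟩⟩
  · rw [Submodule.disjoint_def]
    exact fun y hy hgy => hdis y hy hgy
  · rw [codisjoint_iff, eq_top_iff]
    intro y _
    obtain ⟨r, hr⟩ := hsur (g y)
    refine Submodule.mem_sup.2 ⟨r • f c, Submodule.smul_mem _ _ (Submodule.mem_span_singleton_self _),
      y - r • f c, ?_, by abel⟩
    rw [LinearMap.mem_ker, map_sub, hr, sub_self]
  · constructor
    · rw [← LinearMap.ker_eq_bot, LinearMap.ker_eq_bot']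
      exact fun y hy => Subtype.ext (hdis y y.2 hy)
    · intro z
      obtain ⟨r, hr⟩ := hsur z
      exact ⟨⟨r • f c, Submodule.smul_mem _ _ (Submodule.mem_span_singleton_self _)⟩, hr⟩

variable [IsArtinianRing R] [IsNoetherianRing R]

section Cover

variable {N : Type u} [AddCommGroup N] [Module R N] {n : ℕ}
  (f : (Fin n → R) →ₗ[R] N) (hf : Function.Surjective f)
  (hk : LinearMap.ker f ≤ maximalIdeal R • ⊤)

theorem len_ker_add_radLen_of_cover (hf : Function.Surjective f)
    (hk : LinearMap.ker f ≤ maximalIdeal R • ⊤) :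
    len R (LinearMap.ker f) + radLen R N = n * len R (maximalIdeal R) := by
  have h := len_ker_add_range (f.domRestrict (maximalIdeal R • ⊤))
  rw [len_smul_top_fun] at h
  rw [← h, LinearMap.ker_domRestrict, LinearMap.range_domRestrict, Submodule.map_smul'',
    Submodule.map_top, LinearMap.range_eq_top.2 hf,
    ← len_comap_subtype hk]
  rfl

theorem len_eq_of_cover (hf : Function.Surjective f)
    (hk : LinearMap.ker f ≤ maximalIdeal R • ⊤) : len R N = n + radLen R N := by
  have h1 := len_add_len_ker_of_cover f hf
  have h2 := len_ker_add_radLen_of_cover f hf hk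
  rw [len_self, mul_add] at h1
  omega

end Cover

/-- Since `𝔪 T = 0`, `𝔪 N` depends only on lifts of generators of `N/T`, and `𝔪² N ⊆ 𝔪 T = 0`. So `𝔪
N` is a quotient of `(𝔪/𝔪²)^w` with `w` the length of `N/T`; the inequality is written without
subtraction. -/
theorem radLen_le_of_killed {N : Type u} [AddCommGroup N] [Module R N] [Module.Finite R N]
    (T : Submodule R N) (hT : maximalIdeal R • T = ⊥) (hm : maximalIdeal R • ⊤ ≤ T) :
    radLen R N + embDim R * len R T ≤ embDim R * len R N := by
  obtain ⟨w, g, hg, hgk⟩ := exists_minimal_free_cover (R := R) (N ⧸ T)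
  have hQ : radLen R (N ⧸ T) = 0 := by
    have : (maximalIdeal R • ⊤ : Submodule R (N ⧸ T)) = ⊥ := by
      rw [eq_bot_iff, ← T.range_mkQ, ← Submodule.map_top, ← Submodule.map_smul'']
      exact (Submodule.map_mono hm).trans (by simp)
    rw [radLen, this, len, Module.length_bot]
    rfl
  have hw := len_eq_of_cover g hg hgk
  rw [hQ, add_zero] at hw
  choose v hv using fun j => T.mkQ_surjective (g (Pi.single j 1))
  let L := Fintype.linearCombination R v
  have hL : ∀ c, T.mkQ (L c) = g c := by
    intro c
    rw [Fintype.linearCombination_apply, map_sum]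
    conv_rhs => rw [show c = ∑ j, c j • (Pi.single j (1 : R) : Fin w → R) by
      ext j; simp [Finset.sum_apply, Pi.single_apply]]
    rw [map_sum]
    exact Finset.sum_congr rfl fun j _ => by rw [map_smul, map_smul, hv]
  have key := len_ker_add_range (L.domRestrict (maximalIdeal R • ⊤))
  have hr : radLen R N ≤ len R (LinearMap.range (L.domRestrict (maximalIdeal R • ⊤))) := by
    refine len_submodule_mono ?_
    rw [LinearMap.range_domRestrict, Submodule.map_smul'', Submodule.map_top]
    refine Submodule.smul_le.2 fun r hr x _ => ?_
    obtain ⟨c, hc⟩ := hg (T.mkQ x)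
    have hx : x - L c ∈ T := by
      rw [← T.ker_mkQ, LinearMap.mem_ker, map_sub, hL, hc, sub_self]
    have h0 : r • (x - L c) = 0 := by
      have : r • (x - L c) ∈ maximalIdeal R • T := Submodule.smul_mem_smul hr hx
      rwa [hT, Submodule.mem_bot] at this
    rw [smul_sub, sub_eq_zero] at h0
    rw [h0]
    exact Submodule.smul_mem_smul hr ⟨c, rfl⟩
  have hle : (maximalIdeal R ^ 2 • ⊤ : Submodule R (Fin w → R)) ≤ maximalIdeal R • ⊤ :=
    Submodule.smul_mono_left (Ideal.pow_le_self two_ne_zero)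
  have hker : w * len R (maximalIdeal R ^ 2 : Ideal R) ≤
      len R (LinearMap.ker (L.domRestrict (maximalIdeal R • ⊤))) := by
    rw [← len_smul_top_fun, ← len_comap_subtype hle]
    refine len_submodule_mono ?_
    rw [LinearMap.ker_domRestrict]
    refine Submodule.comap_mono ?_
    refine Submodule.smul_le.2 fun r hr c _ => ?_
    have : r • L c ∈ maximalIdeal R ^ 2 • (⊤ : Submodule R N) :=
      Submodule.smul_mem_smul hr trivial
    rw [sq, ← smul_eq_mul, Submodule.smul_assoc] at this
    have h0 := hT.le (Submodule.smul_mono le_rfl hm this)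
    rwa [LinearMap.mem_ker, map_smul]
  rw [len_smul_top_fun, len_maximalIdeal, mul_add] at key
  have h1 := len_submodule_add_quotient T
  have h2 : radLen R N ≤ w * embDim R := by omega
  rw [← h1, mul_add, hw, mul_comm _ w]
  omega

end Rings

/-! ### Syzygies in minimal free resolutions -/

section Resolution

variable {R : Type u} [CommRing R]

theorem smul_top_eq_bot_of_le {N : Type*} [AddCommGroup N] [Module R N] {X Y : Submodule R N}
    {I : Ideal R} (h : X ≤ Y) (hI : I • Y = ⊥) : I • (⊤ : Submodule R X) = ⊥ := by
  refine Submodule.map_injective_of_injective X.injective_subtype ?_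
  rw [Submodule.map_smul'', Submodule.map_subtype_top, Submodule.map_bot, eq_bot_iff, ← hI]
  exact Submodule.smul_mono le_rfl h

theorem smul_ker_eq_bot_of_mul_eq_bot {n : ℕ} {I J : Ideal R} (h : I * J = ⊥) :
    I • (J • ⊤ : Submodule R (Fin n → R)) = ⊥ := by
  rw [← Submodule.smul_assoc, smul_eq_mul, h, Submodule.bot_smul]

theorem smul_top_le_ker {N F : Type*} [AddCommGroup N] [Module R N] [AddCommGroup F] [Module R F]
    (f : F →ₗ[R] N) {I : Ideal R}
    (h : I • (⊤ : Submodule R N) = ⊥) : I • (⊤ : Submodule R F) ≤ LinearMap.ker f := by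
  rw [LinearMap.ker, ← Submodule.map_le_iff_le_comap, Submodule.map_smul'', ← h]
  exact Submodule.smul_mono le_rfl le_top

variable [IsLocalRing R]

theorem socleRank_eq_len : socleRank R = len R (socle R) :=
  residueRank_eq_len _

theorem mul_socle : maximalIdeal R * socle R = ⊥ := by
  rw [eq_bot_iff, Ideal.mul_le]
  intro r hr s hs
  exact (Submodule.mem_torsionBySet_iff _ _).1 hs ⟨r, hr⟩

theorem sq_le_socle (h3 : maximalIdeal R ^ 3 = ⊥) : maximalIdeal R ^ 2 ≤ socle R := by
  intro x hx
  refine (Submodule.mem_torsionBySet_iff _ _).2 fun r => ?_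
  have : (r : R) * x ∈ maximalIdeal R ^ 3 := by
    rw [pow_succ' (maximalIdeal R) 2]
    exact Ideal.mul_mem_mul r.2 hx
  rwa [h3] at this

section

variable {M : Type u} [AddCommGroup M] [Module R M]

namespace MinimalFreeResolution

theorem ker_aug_le (F : MinimalFreeResolution R M) :
    LinearMap.ker F.aug ≤ maximalIdeal R • ⊤ := F.exact_zero ▸ F.minimal 0

/-- The minimal free resolution of the first syzygy. -/
def tail (F : MinimalFreeResolution R M) : MinimalFreeResolution R (LinearMap.range (F.d 0)) where
  rank i := F.rank (i + 1)
  aug := (F.d 0).rangeRestrict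
  d i := F.d (i + 1)
  aug_surjective := LinearMap.surjective_rangeRestrict _
  exact_zero := by rw [LinearMap.ker_rangeRestrict, F.exact_succ]
  exact_succ i := F.exact_succ (i + 1)
  minimal i := F.minimal (i + 1)

theorem residueSummand_tail (F : MinimalFreeResolution R M) (i : ℕ) :
    F.tail.ResidueSummandOfSyzygy i ↔ F.ResidueSummandOfSyzygy (i + 1) := by
  cases i <;> rfl

/-- The length of `𝔪 M_i`, where `M_i` is the `i`-th syzygy. -/
noncomputable def syzygyRadLen (F : MinimalFreeResolution R M) : ℕ → ℕ
  | 0 => radLen R M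
  | i + 1 => radLen R (LinearMap.range (F.d i))

theorem syzygyRadLen_tail (F : MinimalFreeResolution R M) (i : ℕ) :
    F.tail.syzygyRadLen i = F.syzygyRadLen (i + 1) := by
  cases i <;> rfl

/-- The first syzygy is annihilated by every ideal annihilating the maximal ideal. -/
theorem smul_syzygy_eq_bot (F : MinimalFreeResolution R M) {I : Ideal R}
    (hI : I * maximalIdeal R = ⊥) : I • (⊤ : Submodule R (LinearMap.range (F.d 0))) = ⊥ :=
  smul_top_eq_bot_of_le (F.minimal 0) (smul_ker_eq_bot_of_mul_eq_bot hI)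

theorem exists_prod_of_residueSummand [IsNoetherianRing R] [Module.Finite R M]
    (h : HasResidueSummand R M) :
    ∃ (Q : Type u) (_ : AddCommGroup Q) (_ : Module R Q) (_ : Module.Finite R Q),
      Nonempty ((ResidueField R × Q) ≃ₗ[R] M) := by
  obtain ⟨P, Q, hPQ, ⟨e⟩⟩ := h
  exact ⟨Q, inferInstance, inferInstance, inferInstance,
    ⟨(e.symm.prodCongr (LinearEquiv.refl R Q)).trans (Submodule.prodEquivOfIsCompl P Q hPQ)⟩⟩

end MinimalFreeResolution

end

variable [IsNoetherianRing R] [IsArtinianRing R]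

section Cover

variable {N : Type u} [AddCommGroup N] [Module R N] {n : ℕ} (f : (Fin n → R) →ₗ[R] N)

theorem radLen_ker_le_of_cover (hk : LinearMap.ker f ≤ maximalIdeal R • ⊤) :
    radLen R (LinearMap.ker f) ≤ n * len R (maximalIdeal R ^ 2 : Ideal R) := by
  rw [radLen_submodule, ← len_smul_top_fun, sq, ← smul_eq_mul, Submodule.smul_assoc]
  exact len_submodule_mono (Submodule.smul_mono le_rfl hk)

/-- `radLen_le_of_killed` applied to `T = Soc R · R^n`, which lies in the kernel because the socle
kills `N`, and contains `𝔪` times the kernel because `𝔪² ⊆ Soc R`. -/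
theorem radLen_ker_add_le_of_cover (hk : LinearMap.ker f ≤ maximalIdeal R • ⊤)
    (h3 : maximalIdeal R ^ 3 = ⊥) (hN : socle R • (⊤ : Submodule R N) = ⊥) :
    radLen R (LinearMap.ker f) + embDim R * (n * len R (socle R)) ≤
      embDim R * len R (LinearMap.ker f) := by
  have hle : socle R • ⊤ ≤ LinearMap.ker f := smul_top_le_ker f hN
  rw [← len_smul_top_fun, ← len_comap_subtype hle]
  refine radLen_le_of_killed _ ?_ ?_
  · refine Submodule.map_injective_of_injective (LinearMap.ker f).injective_subtype ?_
    rw [Submodule.map_smul'', Submodule.map_comap_subtype, Submodule.map_bot, eq_bot_iff,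
      ← smul_ker_eq_bot_of_mul_eq_bot (mul_socle (R := R))]
    exact Submodule.smul_mono le_rfl inf_le_right
  · rw [← Submodule.map_le_iff_le_comap, Submodule.map_smul'', Submodule.map_subtype_top]
    refine (Submodule.smul_mono le_rfl hk).trans ?_
    rw [← Submodule.smul_assoc, smul_eq_mul, ← sq]
    exact Submodule.smul_mono (sq_le_socle h3) le_rfl

/-- The kernel contains `𝔪² R^n`, which `𝔪` kills. If `𝔪 · ker f` is too short to contain it, some
element of `𝔪² R^n` is a minimal generator of the kernel. -/
theorem exists_residueSummand_ker_of_cover (h3 : maximalIdeal R ^ 3 = ⊥) (hN : maximalIdeal R ^ 2 • (⊤ : Submodule R N) = ⊥)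
    (hlt : radLen R (LinearMap.ker f) < n * len R (maximalIdeal R ^ 2 : Ideal R)) :
    HasResidueSummand R (LinearMap.ker f) := by
  have hle : maximalIdeal R ^ 2 • ⊤ ≤ LinearMap.ker f := smul_top_le_ker f hN
  rw [radLen_submodule, ← len_smul_top_fun] at hlt
  have hnot : ¬ (maximalIdeal R ^ 2 • ⊤ ≤ maximalIdeal R • LinearMap.ker f) := fun h =>
    hlt.not_ge (len_submodule_mono h)
  obtain ⟨x, hx, hxk⟩ := SetLike.not_le_iff_exists.1 hnot
  refine exists_residueSummand (x := ⟨x, hle hx⟩) (fun r hr => Subtype.ext ?_) fun h => hxk ?_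
  · have : r • x ∈ maximalIdeal R • (maximalIdeal R ^ 2 • ⊤ : Submodule R (Fin n → R)) :=
      Submodule.smul_mem_smul hr hx
    rwa [smul_ker_eq_bot_of_mul_eq_bot (by rw [← pow_succ', h3])] at this
  · have := Submodule.mem_map_of_mem (f := (LinearMap.ker f).subtype) h
    rwa [Submodule.map_smul'', Submodule.map_subtype_top] at this

end Cover

namespace MinimalFreeResolution

variable {M : Type u} [AddCommGroup M] [Module R M]

theorem rank_eq_betti (F : MinimalFreeResolution R M) (i : ℕ) : F.rank i = betti R M i := by
  induction i generalizing M with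
  | zero => exact (betti_zero_of_cover F.aug F.aug_surjective F.ker_aug_le).symm
  | succ i ih =>
    rw [betti_succ_of_cover F.aug F.aug_surjective F.ker_aug_le,
      ← betti_congr (LinearEquiv.ofEq _ _ F.exact_zero), ← ih F.tail]
    rfl

theorem rank_add_radLen (F : MinimalFreeResolution R M) (i : ℕ) :
    F.rank (i + 1) + F.syzygyRadLen (i + 1) + F.syzygyRadLen i =
      F.rank i * len R (maximalIdeal R) := by
  induction i generalizing M with
  | zero =>
    rw [← len_ker_add_radLen_of_cover F.aug F.aug_surjective F.ker_aug_le, ← F.exact_zero,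
      len_eq_of_cover F.tail.aug F.tail.aug_surjective F.tail.ker_aug_le]
    rfl
  | succ i ih =>
    have := ih F.tail
    rwa [syzygyRadLen_tail, syzygyRadLen_tail] at this

theorem syzygyRadLen_succ_le (F : MinimalFreeResolution R M) (i : ℕ) :
    F.syzygyRadLen (i + 1) ≤ F.rank i * len R (maximalIdeal R ^ 2 : Ideal R) := by
  induction i generalizing M with
  | zero =>
    have := radLen_ker_le_of_cover F.aug F.ker_aug_le
    rwa [← F.exact_zero] at this
  | succ i ih =>
    have := ih F.tail
    rwa [syzygyRadLen_tail] at this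

theorem socle_inequality_zero (F : MinimalFreeResolution R M) (h3 : maximalIdeal R ^ 3 = ⊥)
    (hM : socle R • (⊤ : Submodule R M) = ⊥) :
    F.syzygyRadLen 1 + embDim R * (F.rank 0 * len R (socle R)) ≤
      embDim R * (F.rank 1 + F.syzygyRadLen 1) := by
  have h := radLen_ker_add_le_of_cover F.aug F.ker_aug_le h3 hM
  rw [← F.exact_zero, len_eq_of_cover F.tail.aug F.tail.aug_surjective F.tail.ker_aug_le] at h
  exact h

/-- The index starts at 2 because the socle must kill the preceding module, which is guaranteed only
for syzygies of index at least 1. -/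
theorem socle_inequality (F : MinimalFreeResolution R M) (h3 : maximalIdeal R ^ 3 = ⊥) (i : ℕ) :
    F.syzygyRadLen (i + 2) + embDim R * (F.rank (i + 1) * len R (socle R)) ≤
      embDim R * (F.rank (i + 2) + F.syzygyRadLen (i + 2)) := by
  induction i generalizing M with
  | zero =>
    exact F.tail.socle_inequality_zero h3
      (F.smul_syzygy_eq_bot (by rw [mul_comm, mul_socle]))
  | succ i ih =>
    have := ih F.tail
    rwa [syzygyRadLen_tail] at this

theorem syzygyRadLen_zero_le (F : MinimalFreeResolution R M) [Module.Finite R M]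
    (hM : maximalIdeal R ^ 2 • (⊤ : Submodule R M) = ⊥) :
    F.syzygyRadLen 0 ≤ embDim R * F.rank 0 := by
  have h := radLen_le_of_killed (maximalIdeal R • (⊤ : Submodule R M))
    (by rw [← Submodule.smul_assoc, smul_eq_mul, ← sq, hM]) le_rfl
  rw [len_eq_of_cover F.aug F.aug_surjective F.ker_aug_le, mul_add] at h
  exact Nat.le_of_add_le_add_right h

theorem syzygyRadLen_le (F : MinimalFreeResolution R M) (h3 : maximalIdeal R ^ 3 = ⊥) (i : ℕ) :
    F.syzygyRadLen (i + 1) ≤ embDim R * F.rank (i + 1) := by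
  induction i generalizing M with
  | zero => exact F.tail.syzygyRadLen_zero_le (F.smul_syzygy_eq_bot (by rw [← pow_succ, h3]))
  | succ i ih =>
    have := ih F.tail
    rwa [syzygyRadLen_tail] at this

theorem residueSummand_of_lt (F : MinimalFreeResolution R M) (h3 : maximalIdeal R ^ 3 = ⊥) (i : ℕ)
    (h : F.syzygyRadLen (i + 2) < F.rank (i + 1) * len R (maximalIdeal R ^ 2 : Ideal R)) :
    F.ResidueSummandOfSyzygy (i + 2) := by
  induction i generalizing M with
  | zero =>
    have h' := exists_residueSummand_ker_of_cover F.tail.aug h3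
      (F.smul_syzygy_eq_bot (by rw [← pow_succ, h3]))
    rw [← F.tail.exact_zero] at h'
    exact h' h
  | succ i ih =>
    rw [← residueSummand_tail]
    rw [← syzygyRadLen_tail] at h
    exact ih F.tail h

instance finite_residueField : Module.Finite R (ResidueField R) :=
  Module.Finite.of_surjective (Algebra.linearMap R (ResidueField R)) residue_surjective

theorem rank_prod {P Q : Type u} [AddCommGroup P] [Module R P] [Module.Finite R P]
    [AddCommGroup Q] [Module R Q] [Module.Finite R Q] (e : (P × Q) ≃ₗ[R] M)
    (F : MinimalFreeResolution R M) (G : MinimalFreeResolution R P)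
    (H : MinimalFreeResolution R Q) (i : ℕ) : F.rank i = G.rank i + H.rank i := by
  rw [rank_eq_betti, rank_eq_betti, rank_eq_betti, ← betti_congr e, betti_prod]

/-- The syzygies need not be decomposed: additivity of Betti numbers and `rank_add_radLen` determine
each value from the previous one. -/
theorem syzygyRadLen_prod {P Q : Type u} [AddCommGroup P] [Module R P] [Module.Finite R P]
    [AddCommGroup Q] [Module R Q] [Module.Finite R Q] (e : (P × Q) ≃ₗ[R] M)
    (F : MinimalFreeResolution R M) (G : MinimalFreeResolution R P)
    (H : MinimalFreeResolution R Q) (i : ℕ) :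
    F.syzygyRadLen i = G.syzygyRadLen i + H.syzygyRadLen i := by
  induction i with
  | zero =>
    have hF := len_eq_of_cover F.aug F.aug_surjective F.ker_aug_le
    have hG := len_eq_of_cover G.aug G.aug_surjective G.ker_aug_le
    have hH := len_eq_of_cover H.aug H.aug_surjective H.ker_aug_le
    rw [← len_congr e, len_prod] at hF
    have := rank_prod e F G H 0
    simp only [syzygyRadLen]
    omega
  | succ i ih =>
    have hF := F.rank_add_radLen i
    have hG := G.rank_add_radLen i
    have hH := H.rank_add_radLen i
    have h := rank_prod e F G H (i + 1)
    rw [rank_prod e F G H i, add_mul] at hF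
    omega

/-- Both sides of `syzygyRadLen_le` are additive, so equality for a direct sum forces equality for
each summand. The shift `n + 1` keeps to true syzygies, where that bound holds. -/
theorem syzygyRadLen_eq_of_summand (F : MinimalFreeResolution R M) [Module.Finite R M]
    (G : MinimalFreeResolution R (ResidueField R)) (h3 : maximalIdeal R ^ 3 = ⊥) (i n : ℕ)
    (hs : F.ResidueSummandOfSyzygy i)
    (h : F.syzygyRadLen (i + (n + 1)) = embDim R * F.rank (i + (n + 1))) :
    G.syzygyRadLen (n + 1) = embDim R * G.rank (n + 1) := by
  induction i generalizing M with
  | zero =>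
    obtain ⟨Q, _, _, _, ⟨e⟩⟩ := exists_prod_of_residueSummand hs
    obtain ⟨H⟩ := nonempty_minimalFreeResolution (R := R) Q
    rw [zero_add, syzygyRadLen_prod e F G H, rank_prod e F G H, mul_add] at h
    have h1 := G.syzygyRadLen_le h3 n
    have h2 := H.syzygyRadLen_le h3 n
    omega
  | succ i ih =>
    rw [show i + 1 + (n + 1) = (i + (n + 1)) + 1 by ring, ← syzygyRadLen_tail] at h
    exact ih F.tail ((F.residueSummand_tail i).2 hs) h

theorem rank_zero_residueField (G : MinimalFreeResolution R (ResidueField R)) :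
    G.rank 0 = 1 ∧ G.syzygyRadLen 0 = 0 := by
  have h0 : G.syzygyRadLen 0 = 0 := by
    have : (maximalIdeal R • ⊤ : Submodule R (ResidueField R)) = ⊥ := by
      rw [eq_bot_iff]
      intro x hx
      exact apply_eq_zero_of_mem_smul_top LinearMap.id hx
    rw [syzygyRadLen, radLen, this, len, Module.length_bot]
    rfl
  have h := len_eq_of_cover G.aug G.aug_surjective G.ker_aug_le
  rw [len_residueField] at h
  simp only [syzygyRadLen] at h0 ⊢
  omega

/-- A summand `k` adds 1 to the rank and nothing to `𝔪 N`, so the bound drops by `e`. -/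
theorem syzygyRadLen_lt_of_summand (F : MinimalFreeResolution R M) (h3 : maximalIdeal R ^ 3 = ⊥)
    (he : 0 < embDim R) (i : ℕ) (hs : F.ResidueSummandOfSyzygy (i + 1)) :
    F.syzygyRadLen (i + 1) < embDim R * F.rank (i + 1) := by
  induction i generalizing M with
  | zero =>
    obtain ⟨Q, _, _, _, ⟨e⟩⟩ := exists_prod_of_residueSummand hs
    obtain ⟨H⟩ := nonempty_minimalFreeResolution (R := R) Q
    obtain ⟨G⟩ := nonempty_minimalFreeResolution (R := R) (ResidueField R)
    have hM := F.smul_syzygy_eq_bot (I := maximalIdeal R ^ 2) (by rw [← pow_succ, h3])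
    have hQ : maximalIdeal R ^ 2 • (⊤ : Submodule R Q) = ⊥ := by
      rw [eq_bot_iff]
      refine Submodule.smul_le.2 fun r hr q _ => ?_
      have h0 : r • e (0, q) ∈ maximalIdeal R ^ 2 • ⊤ := Submodule.smul_mem_smul hr trivial
      rw [hM, Submodule.mem_bot, ← map_smul, e.map_eq_zero_iff] at h0
      exact congrArg Prod.snd h0
    have h1 := H.syzygyRadLen_zero_le hQ
    have h2 := syzygyRadLen_prod e F.tail G H 0
    have h3 := rank_prod e F.tail G H 0
    obtain ⟨h4, h5⟩ := G.rank_zero_residueField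
    rw [← syzygyRadLen_tail, h2, h5, zero_add]
    change _ < embDim R * F.tail.rank 0
    rw [h3, h4, mul_add]
    omega
  | succ i ih =>
    rw [← syzygyRadLen_tail]
    exact ih F.tail ((F.residueSummand_tail _).2 hs)

end MinimalFreeResolution

end Resolution

/-! ### Socle of length at most one implies self-injective -/

section Gorenstein

variable {R : Type u} [CommRing R] [IsLocalRing R]

theorem length_eq_ker_add_range {R : Type*} [CommRing R] {M P : Type*} [AddCommGroup M]
    [Module R M] [AddCommGroup P] [Module R P] (f : M →ₗ[R] P) :
    Module.length R M =
      Module.length R (LinearMap.ker f) + Module.length R (LinearMap.range f) := by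
  rw [← f.quotKerEquivRange.length_eq]
  exact Module.length_eq_add_of_exact (LinearMap.ker f).subtype (LinearMap.ker f).mkQ
    (LinearMap.ker f).injective_subtype (LinearMap.ker f).mkQ_surjective
    (LinearMap.exact_subtype_mkQ _)

/-- Induction on length: a map vanishing on `N`, with `M/N` simple, is determined by the image of
one element, and that image lies in the socle. -/
theorem length_hom_le {M : Type u} [AddCommGroup M] [Module R M]
    (hs : Module.length R (socle R) ≤ 1) (hM : IsFiniteLength R M) :
    Module.length R (M →ₗ[R] R) ≤ Module.length R M := by
  induction hM with
  | of_subsingleton =>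
    rw [Module.length_eq_zero]
    exact zero_le
  | @of_simple_quotient M _ _ N _ hN ih =>
    have h1 := Module.length_eq_add_of_exact N.subtype N.mkQ N.injective_subtype N.mkQ_surjective
      (LinearMap.exact_subtype_mkQ N)
    let ρ : (M →ₗ[R] R) →ₗ[R] (N →ₗ[R] R) := LinearMap.lcomp R R N.subtype
    have h2 := length_eq_ker_add_range ρ
    obtain ⟨I, hI, ⟨e⟩⟩ := isSimpleModule_iff_quot_maximal.1
      (inferInstance : IsSimpleModule R (M ⧸ N))
    obtain rfl := eq_maximalIdeal hI
    obtain ⟨x, hx⟩ := N.mkQ_surjective (e.symm (Ideal.Quotient.mk _ 1))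
    have hxN : ∀ r ∈ maximalIdeal R, r • x ∈ N := by
      intro r hr
      rw [← Submodule.ker_mkQ N, LinearMap.mem_ker, map_smul, hx, ← map_smul,
        LinearEquiv.map_eq_zero_iff]
      exact (Ideal.Quotient.eq_zero_iff_mem).2 (by simpa using hr)
    have hgen : ∀ y : M, ∃ r : R, y - r • x ∈ N := by
      intro y
      obtain ⟨r, hr⟩ := Ideal.Quotient.mk_surjective (e (N.mkQ y))
      refine ⟨r, ?_⟩
      rw [← Submodule.ker_mkQ N, LinearMap.mem_ker, map_sub, map_smul, hx, ← map_smul, sub_eq_zero,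
        LinearEquiv.eq_symm_apply, ← hr]
      simp [Algebra.smul_def]
    have hz : ∀ f : LinearMap.ker ρ, ∀ y ∈ N, (f : M →ₗ[R] R) y = 0 := fun f y hy =>
      LinearMap.congr_fun (LinearMap.mem_ker.1 f.2) ⟨y, hy⟩
    let ev : LinearMap.ker ρ →ₗ[R] socle R :=
      ((LinearMap.applyₗ x) ∘ₗ (LinearMap.ker ρ).subtype).codRestrict (socle R) fun f => by
        refine (Submodule.mem_torsionBySet_iff _ _).2 fun r => ?_
        change (r : R) • (f : M →ₗ[R] R) x = 0
        rw [← map_smul]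
        exact hz f _ (hxN r r.2)
    have hev : Function.Injective ev := by
      intro f g hfg
      have hfx : (f : M →ₗ[R] R) x = (g : M →ₗ[R] R) x := congrArg Subtype.val hfg
      refine Subtype.ext (LinearMap.ext fun y => ?_)
      obtain ⟨r, hr⟩ := hgen y
      have hf := hz f _ hr
      have hg := hz g _ hr
      rw [map_sub, map_smul, sub_eq_zero] at hf hg
      rw [hf, hg, hfx]
    rw [h1, h2, add_comm]
    refine add_le_add ((Module.length_le_of_injective (LinearMap.range ρ).subtype
      (LinearMap.range ρ).injective_subtype).trans ih) ?_
    rw [Module.length_eq_one R (M ⧸ N)]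
    exact (Module.length_le_of_injective ev hev).trans hs

/-- Baer's criterion by counting: the kernel of `Hom(R,R) → Hom(I,R)` has length at most that of
`R/I`, so the image has length at least that of `I`, which already bounds `Hom(I,R)`. -/
theorem isGorensteinLocal_of_len_socle_le_one [IsNoetherianRing R] [IsArtinianRing R]
    (hs : len R (socle R) ≤ 1) : IsGorensteinLocal R := by
  have hs' : Module.length R (socle R) ≤ 1 := by
    rw [← ENat.natCast_toNat (Module.length_ne_top (R := R) (M := socle R))]
    exact_mod_cast hs
  have hfin : ∀ (M : Type u) [AddCommGroup M] [Module R M] [Module.Finite R M],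
      IsFiniteLength R M := fun M _ _ _ => Module.length_ne_top_iff.1 Module.length_ne_top
  refine ⟨inferInstance, 0, ?_⟩
  have hinj : Module.Injective R R := by
    refine Module.Baer.injective (Module.Baer.iff_surjective.2 fun I => ?_)
    let ρ : (R →ₗ[R] R) →ₗ[R] (I →ₗ[R] R) := LinearMap.lcomp R R I.subtype
    change Function.Surjective ρ
    have hI := length_hom_le hs' (hfin I)
    have hQ := length_hom_le hs' (hfin (R ⧸ I))
    have hItop : Module.length R I ≠ ⊤ := Module.length_ne_top
    have hfl : IsFiniteLength R (I →ₗ[R] R) :=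
      Module.length_ne_top_iff.1 (hI.trans_lt hItop.lt_top).ne
    obtain ⟨_, _⟩ := isFiniteLength_iff_isNoetherian_isArtinian.1 hfl
    have h1 := Module.length_eq_add_of_exact I.subtype I.mkQ I.injective_subtype I.mkQ_surjective
      (LinearMap.exact_subtype_mkQ I)
    have h2 := length_eq_ker_add_range ρ
    rw [(LinearMap.ringLmapEquivSelf R R R).length_eq, h1] at h2
    let τ : ((R ⧸ I) →ₗ[R] R) →ₗ[R] (R →ₗ[R] R) := LinearMap.lcomp R R I.mkQ
    have hτ : LinearMap.ker ρ ≤ LinearMap.range τ := by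
      intro f hf
      have hle : I ≤ LinearMap.ker f := fun y hy =>
        LinearMap.congr_fun (LinearMap.mem_ker.1 hf) ⟨y, hy⟩
      exact ⟨Submodule.liftQ I f hle, Submodule.liftQ_mkQ I f hle⟩
    have h3 : Module.length R (LinearMap.ker ρ) ≤ Module.length R (R ⧸ I) :=
      ((Module.length_le_of_injective (Submodule.inclusion hτ)
        (Submodule.inclusion_injective hτ)).trans
        (le_add_self.trans (length_eq_ker_add_range τ).ge)).trans hQ
    rw [← LinearMap.range_eq_top]
    by_contra hne
    have h4 := (Submodule.length_lt hne).trans_le hI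
    have hQtop : Module.length R (R ⧸ I) ≠ ⊤ := Module.length_ne_top
    have h5 := ENat.add_lt_add_of_le_of_lt (h3.trans_lt hQtop.lt_top).ne h3 h4
    rw [← h2, add_comm] at h5
    exact lt_irrefl _ h5
  have := (Module.injective_iff_injective_object R R).1 hinj
  infer_instance

end Gorenstein

/-! ### The second syzygy of `k` in embedding dimension 2 or 3 -/

section Koszul

variable {R : Type u} [CommRing R] [IsLocalRing R]

theorem exists_ne_zero_dual_family [IsNoetherianRing R] {V : Type u} [AddCommGroup V] [Module R V]
    [Module.Finite R V]
    (hV : Module.IsTorsionBySet R V (maximalIdeal R)) {n t : ℕ} (u v : Fin t → Fin n × V)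
    (ht : t < n * len R V) :
    ∃ ψ : Fin n → V →ₗ[R] ResidueField R, ψ ≠ 0 ∧
      ∀ s, ψ (u s).1 (u s).2 = ψ (v s).1 (v s).2 := by
  let : Module (ResidueField R) V := hV.module
  have : IsScalarTower R (ResidueField R) V := hV.isScalarTower
  have : Module.Finite (ResidueField R) V := Module.Finite.of_restrictScalars_finite R _ _
  have hlen : len R V = Module.finrank (ResidueField R) V := (residueRank_eq_len hV).symm
  let Θ : (Fin n → Module.Dual (ResidueField R) V) →ₗ[ResidueField R] (Fin t → ResidueField R) :=
    LinearMap.pi fun s =>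
      (LinearMap.applyₗ (u s).2) ∘ₗ (LinearMap.proj (u s).1) -
        (LinearMap.applyₗ (v s).2) ∘ₗ (LinearMap.proj (v s).1)
  have hker : LinearMap.ker Θ ≠ ⊥ := by
    refine LinearMap.ker_ne_bot_of_finrank_lt ?_
    have h1 : Module.finrank (ResidueField R) (Fin n → Module.Dual (ResidueField R) V) =
        n * len R V := by
      rw [Module.finrank_pi_fintype]
      simp [Subspace.dual_finrank_eq, hlen]
    rw [h1]
    simpa using ht
  obtain ⟨φ, hφ, hne⟩ := Submodule.exists_mem_ne_zero_of_ne_bot hker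
  refine ⟨fun l => (φ l).restrictScalars R, fun h => hne ?_, fun s => ?_⟩
  · funext l
    exact LinearMap.ext fun x => LinearMap.congr_fun (congrFun h l) x
  · exact sub_eq_zero.1 (congrFun (LinearMap.mem_ker.1 hφ) s)

/-- Dimension count. Given `p i j = p j i`, full symmetry of `ψ l (p i j)` amounts to `(n³ - n)/3`
linear conditions on `n²` unknowns: 2 against 4 for `n = 2`, 8 against 9 for `n = 3`. The count
fails from `n = 4` on. -/
theorem exists_symmetric_dual_family [IsNoetherianRing R] {V : Type u} [AddCommGroup V]
    [Module R V] [Module.Finite R V]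
    (hV : Module.IsTorsionBySet R V (maximalIdeal R)) {n : ℕ} (hn : n = 2 ∨ n = 3)
    (p : Fin n → Fin n → V) (hp : ∀ i j, p i j = p j i)
    (hlen : len R V = n) :
    ∃ ψ : Fin n → V →ₗ[R] ResidueField R, ψ ≠ 0 ∧ ∀ i j l, ψ l (p i j) = ψ i (p l j) := by
  rcases hn with rfl | rfl
  · obtain ⟨ψ, hne, h⟩ := exists_ne_zero_dual_family hV (n := 2)
      ![(1, p 0 0), (1, p 0 1)] ![(0, p 1 0), (0, p 1 1)] (by omega)
    refine ⟨ψ, hne, ?_⟩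
    have h0 : ψ 1 (p 0 0) = ψ 0 (p 1 0) := h 0
    have h1 : ψ 1 (p 0 1) = ψ 0 (p 1 1) := h 1
    intro i j l
    fin_cases i <;> fin_cases j <;> fin_cases l <;>
      simp only [Fin.zero_eta, Fin.mk_one] <;> grind
  · obtain ⟨ψ, hne, h⟩ := exists_ne_zero_dual_family hV (n := 3)
      ![(1, p 0 0), (1, p 0 1), (2, p 0 0), (2, p 0 2), (2, p 1 1), (2, p 1 2), (1, p 0 2),
        (2, p 0 1)]
      ![(0, p 1 0), (0, p 1 1), (0, p 2 0), (0, p 2 2), (1, p 2 1), (1, p 2 2), (0, p 1 2),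
        (0, p 2 1)] (by omega)
    refine ⟨ψ, hne, ?_⟩
    have h0 : ψ 1 (p 0 0) = ψ 0 (p 1 0) := h 0
    have h1 : ψ 1 (p 0 1) = ψ 0 (p 1 1) := h 1
    have h2 : ψ 2 (p 0 0) = ψ 0 (p 2 0) := h 2
    have h3 : ψ 2 (p 0 2) = ψ 0 (p 2 2) := h 3
    have h4 : ψ 2 (p 1 1) = ψ 1 (p 2 1) := h 4
    have h5 : ψ 2 (p 1 2) = ψ 1 (p 2 2) := h 5
    have h6 : ψ 1 (p 0 2) = ψ 0 (p 1 2) := h 6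
    have h7 : ψ 2 (p 0 1) = ψ 0 (p 2 1) := h 7
    intro i j l
    fin_cases i <;> fin_cases j <;> fin_cases l <;>
      simp only [Fin.zero_eta, Fin.mk_one, Fin.reduceFinMk] <;> grind

/-- The symmetric family `ψ` gives a nonzero functional `Φ` on `𝔪² R^n`. Symmetry lets a multiplier
`x i` trade places with `x l`, turning `Φ (y c)` into values of `ψ` on the relation `∑ c l * x l =
0`; so `Φ` kills `𝔪 K`. -/
theorem not_sq_smul_top_le [IsNoetherianRing R] (h3 : maximalIdeal R ^ 3 = ⊥) {n : ℕ}
    (hn : n = 2 ∨ n = 3)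
    (x : Fin n → R) (hx : Ideal.span (Set.range x) = maximalIdeal R)
    (ha : len R (maximalIdeal R ^ 2 : Ideal R) = n) (K : Submodule R (Fin n → R))
    (hK : ∀ c ∈ K, ∑ l, c l * x l = 0) (hKm : K ≤ maximalIdeal R • ⊤) :
    ¬ maximalIdeal R ^ 2 • ⊤ ≤ maximalIdeal R • K := by
  intro hle
  have hxm : ∀ i, x i ∈ maximalIdeal R := fun i => hx ▸ Ideal.subset_span ⟨i, rfl⟩
  have hmul : ∀ {y z : R}, y ∈ maximalIdeal R → z ∈ maximalIdeal R → y * z ∈ maximalIdeal R ^ 2 :=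
    fun hy hz => by rw [sq]; exact Ideal.mul_mem_mul hy hz
  have hspan : ∀ y ∈ maximalIdeal R, ∃ c : Fin n → R, ∑ i, c i * x i = y := by
    intro y hy
    rw [← hx] at hy
    exact Ideal.mem_span_range_iff_exists_fun.1 hy
  let p : Fin n → Fin n → (maximalIdeal R ^ 2 : Ideal R) := fun i j =>
    ⟨x i * x j, hmul (hxm i) (hxm j)⟩
  obtain ⟨ψ, hne, hψ⟩ := exists_symmetric_dual_family (isTorsionBySet_sq h3) hn p
    (fun i j => Subtype.ext (mul_comm _ _)) ha
  let Φ : (Fin n → (maximalIdeal R ^ 2 : Ideal R)) →ₗ[R] ResidueField R :=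
    ∑ l, ψ l ∘ₗ LinearMap.proj l
  let ι := (maximalIdeal R ^ 2).subtype.compLeft (Fin n)
  have hι : Function.Injective ι := fun y z hyz =>
    funext fun i => Subtype.ext (congrFun hyz i)
  have hKΦ : maximalIdeal R • K ≤ (LinearMap.ker Φ).map ι := by
    refine Submodule.smul_le.2 fun y hy c hc => ?_
    have hcm := (mem_smul_top_fun _).1 (hKm hc)
    obtain ⟨b, hb⟩ := hspan y hy
    choose C hC using fun l => hspan (c l) (hcm l)
    refine ⟨fun l => ⟨y * c l, hmul hy (hcm l)⟩, ?_, rfl⟩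
    have e1 : ∀ l, (⟨y * c l, hmul hy (hcm l)⟩ : (maximalIdeal R ^ 2 : Ideal R)) =
        ∑ i, ∑ j, (b i * C l j) • p i j := by
      intro l
      refine Subtype.ext ?_
      simp only [AddSubmonoidClass.coe_finsetSum, Submodule.coe_smul, smul_eq_mul, p]
      rw [← hb, ← hC l, Finset.sum_mul_sum]
      exact Finset.sum_congr rfl fun i _ => Finset.sum_congr rfl fun j _ => by ring
    have e2 : ∑ l, ∑ j, C l j • p l j = 0 := by
      refine Subtype.ext ?_
      simp only [AddSubmonoidClass.coe_finsetSum, Submodule.coe_smul, smul_eq_mul, p]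
      refine Eq.trans ?_ (hK c hc)
      refine Finset.sum_congr rfl fun l _ => ?_
      rw [← hC l, Finset.sum_mul]
      exact Finset.sum_congr rfl fun j _ => by ring
    change Φ _ = 0
    simp only [Φ, LinearMap.sum_apply, LinearMap.comp_apply, LinearMap.proj_apply, e1]
    calc ∑ l, ψ l (∑ i, ∑ j, (b i * C l j) • p i j)
        = ∑ l, ∑ i, ∑ j, b i • C l j • ψ i (p l j) := by
          simp only [map_sum, map_smul, hψ, mul_smul]
      _ = ∑ i, b i • ψ i (∑ l, ∑ j, C l j • p l j) := by
          rw [Finset.sum_comm]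
          simp only [map_sum, map_smul, Finset.smul_sum]
      _ = 0 := by simp [e2]
  apply hne
  funext l
  ext z
  have hz : ι (Pi.single l z) ∈ (maximalIdeal R ^ 2 • ⊤ : Submodule R (Fin n → R)) :=
    (mem_smul_top_fun _).2 fun i => ((Pi.single l z : Fin n → (maximalIdeal R ^ 2 : Ideal R)) i).2
  obtain ⟨w, hw, hwz⟩ := hKΦ (hle hz)
  obtain rfl := hι hwz
  have : Φ (Pi.single l z) = ψ l z := by
    simp only [Φ, LinearMap.sum_apply, LinearMap.comp_apply, LinearMap.proj_apply]
    rw [Finset.sum_eq_single l]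
    · simp
    · intro i _ hi
      rw [Pi.single_eq_of_ne hi, map_zero]
    · simp
  rw [← this]
  exact hw

theorem MinimalFreeResolution.range_d_zero_residueField
    (G : MinimalFreeResolution R (ResidueField R)) :
    LinearMap.range (G.d 0) = maximalIdeal R • ⊤ := by
  refine le_antisymm (G.minimal 0) (G.exact_zero ▸ smul_top_le_ker G.aug ?_)
  rw [eq_bot_iff]
  exact fun x hx => apply_eq_zero_of_mem_smul_top LinearMap.id hx

variable [IsNoetherianRing R] [IsArtinianRing R]

theorem MinimalFreeResolution.rank_one_residueField
    (G : MinimalFreeResolution R (ResidueField R)) : G.rank 1 = embDim R := by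
  obtain ⟨h0, hs0⟩ := G.rank_zero_residueField
  have hs1 : G.syzygyRadLen 1 = len R (maximalIdeal R ^ 2 : Ideal R) := by
    change radLen R (LinearMap.range (G.d 0)) = _
    rw [radLen_submodule, G.range_d_zero_residueField, ← Submodule.smul_assoc, smul_eq_mul, ← sq,
      len_smul_top_fun, h0, one_mul]
  have : G.rank 1 + G.syzygyRadLen 1 + G.syzygyRadLen 0 = _ := G.rank_add_radLen 0
  rw [h0, len_maximalIdeal] at this
  omega

theorem MinimalFreeResolution.syzygyRadLen_two_lt
    (h3 : maximalIdeal R ^ 3 = ⊥) (G : MinimalFreeResolution R (ResidueField R))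
    (hn : embDim R = 2 ∨ embDim R = 3)
    (ha : len R (maximalIdeal R ^ 2 : Ideal R) = embDim R) :
    G.syzygyRadLen 2 < G.rank 1 * len R (maximalIdeal R ^ 2 : Ideal R) := by
  obtain ⟨h0, -⟩ := G.rank_zero_residueField
  have hrange := G.range_d_zero_residueField
  have h1 := G.rank_one_residueField
  let i₀ : Fin (G.rank 0) := ⟨0, by omega⟩
  have hi₀ : ∀ i, i = i₀ := fun i => Fin.ext (by have := i.2; simp only [i₀]; omega)
  let x : Fin (G.rank 1) → R := fun l => G.d 0 (Pi.single l 1) i₀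
  have hd : ∀ c, G.d 0 c i₀ = ∑ l, c l * x l := by
    intro c
    conv_lhs => rw [show c = ∑ j, c j • (Pi.single j (1 : R) : Fin (G.rank 1) → R) by
      ext j; simp [Finset.sum_apply, Pi.single_apply]]
    rw [map_sum, Finset.sum_apply]
    exact Finset.sum_congr rfl fun j _ => by rw [map_smul]; rfl
  have hx : Ideal.span (Set.range x) = maximalIdeal R := by
    ext y
    rw [Ideal.mem_span_range_iff_exists_fun]
    constructor
    · rintro ⟨c, rfl⟩
      rw [← hd]
      exact (mem_smul_top_fun _).1 (hrange ▸ LinearMap.mem_range_self (G.d 0) c) i₀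
    · intro hy
      have : (fun _ => y) ∈ LinearMap.range (G.d 0) := by
        rw [hrange, mem_smul_top_fun]
        exact fun _ => hy
      obtain ⟨c, hc⟩ := this
      exact ⟨c, by rw [← hd, hc]⟩
  have hnot := not_sq_smul_top_le h3 (n := G.rank 1) (by rwa [h1]) x hx (by rw [ha, h1])
    (LinearMap.range (G.d 1))
    (fun c hc => by rw [← hd, LinearMap.mem_ker.1 ((G.exact_succ 0) ▸ hc)]; rfl) (G.minimal 1)
  have hle : maximalIdeal R • LinearMap.range (G.d 1) ≤ maximalIdeal R ^ 2 • ⊤ := by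
    rw [sq, ← smul_eq_mul, Submodule.smul_assoc]
    exact Submodule.smul_mono le_rfl (G.minimal 1)
  change radLen R (LinearMap.range (G.d 1)) < _
  rw [radLen_submodule, ← len_smul_top_fun]
  exact len_submodule_lt (lt_of_le_not_ge hle hnot)

end Koszul

/-! ### Arithmetic of the syzygy relations -/

section Growth

/-- The numerical relations between the Betti numbers `b i` and the lengths `s i` of `𝔪 M_i`. -/
structure SyzygyRelations (a e r : ℕ) (b s : ℕ → ℕ) : Prop where
  sum_eq : ∀ i, b (i + 1) + s (i + 1) + s i = b i * (e + a)
  le_mul : ∀ i, s (i + 1) ≤ b i * a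
  socle : ∀ i, s (i + 2) + e * (b (i + 1) * r) ≤ e * (b (i + 2) + s (i + 2))

namespace SyzygyRelations

variable {a e r : ℕ} {b s : ℕ → ℕ} (h : SyzygyRelations a e r b s)

include h

theorem linear_bound (i : ℕ) : e * b (i + 1) ≤ b (i + 2) + a * b i := by
  have h1 := h.sum_eq (i + 1)
  have h2 := h.le_mul i
  have h3 := h.le_mul (i + 1)
  rw [mul_add] at h1
  rw [mul_comm e, mul_comm a]
  have : b (i + 1 + 1) = b (i + 2) := rfl
  omega

theorem ratio_bound (he : 0 < e) (har : a ≤ r) (i : ℕ) :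
    (e * (r - a) + a) * b (i + 1) + (e - 1) * (b (i + 1) * a - s (i + 2)) ≤ e * b (i + 2) := by
  obtain ⟨d, rfl⟩ := Nat.exists_eq_add_of_le har
  obtain ⟨e, rfl⟩ := Nat.exists_eq_add_of_le' he
  have h1 := h.socle i
  have h2 : s (i + 2) ≤ b (i + 1) * a := h.le_mul (i + 1)
  obtain ⟨t, ht⟩ := Nat.exists_eq_add_of_le h2
  rw [ht]
  simp only [Nat.add_sub_cancel_left, Nat.add_sub_cancel]
  nlinarith

theorem growth (he : 0 < e) (ha : 0 < a) (har : a ≤ r) (hr : 2 ≤ r) (hb : b 0 < b 1)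
    (hne : a ≠ e ∨ a ≠ r) : StrictMono b ∧ TermwiseExponentialGrowth b := by
  have hpos : 0 < b 1 := by omega
  -- Otherwise `a = r < e`: `r > a` would give `e (r - a) + a > e`, and `a = r = e` is excluded.
  by_cases hc : e < e * (r - a) + a
  · have hstep : ∀ i, (e * (r - a) + a) * b (i + 1) ≤ e * b (i + 2) := fun i =>
      (Nat.le_add_right _ _).trans (h.ratio_bound he har i)
    have hbp : ∀ i, 0 < b (i + 1) := by
      intro i
      induction i with
      | zero => exact hpos
      | succ i ih =>
        have h1 := hstep i
        have h2 : 0 < (e * (r - a) + a) * b (i + 1) := Nat.mul_pos (by omega) ih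
        exact Nat.pos_of_mul_pos_left (h2.trans_le h1)
    constructor
    · refine strictMono_nat_of_lt_succ fun i => ?_
      cases i with
      | zero => exact hb
      | succ i =>
        have h1 : e * b (i + 1) < (e * (r - a) + a) * b (i + 1) :=
          Nat.mul_lt_mul_of_pos_right hc (hbp i)
        exact Nat.lt_of_mul_lt_mul_left (h1.trans_le (hstep i))
    · have he' : (0 : ℝ) < e := by exact_mod_cast he
      refine ⟨((e * (r - a) + a : ℕ) : ℝ) / e, ?_, ?_⟩
      · rw [one_lt_div he']
        exact_mod_cast hc
      · filter_upwards [eventually_ge_atTop 1] with i hi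
        obtain ⟨i, rfl⟩ := Nat.exists_eq_add_of_le' hi
        rw [div_mul_eq_mul_div, div_le_iff₀ he', mul_comm (b (i + 1 + 1) : ℝ)]
        exact_mod_cast hstep i
  · have har' : r = a := by
      by_contra hra
      have : e * 1 ≤ e * (r - a) := Nat.mul_le_mul_left _ (by omega)
      omega
    have hae : a < e := by
      subst har'
      rw [Nat.sub_self] at hc
      omega
    have h3 : (3 : ℝ) ≤ e := by exact_mod_cast (by omega : 3 ≤ e)
    have hrec : ∀ i, (e : ℝ) * b (i + 1) ≤ b (i + 2) + (e - 1) * b i := by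
      intro i
      have h1 := h.linear_bound i
      have h2 : (e : ℝ) * b (i + 1) ≤ b (i + 2) + a * b i := by exact_mod_cast h1
      have h4 : (a : ℝ) + 1 ≤ e := by exact_mod_cast hae
      have h5 : (0 : ℝ) ≤ b i := Nat.cast_nonneg _
      nlinarith
    -- The recurrence has characteristic roots `1` and `e - 1`; a ratio bound `A` between them is
    -- inherited because `A e - (e - 1) - A² = (A - 1)(e - 1 - A) ≥ 0`.
    have hA : ∃ A : ℝ, 1 < A ∧ A ≤ e - 1 ∧ A * b 0 ≤ b 1 := by
      rcases Nat.eq_zero_or_pos (b 0) with h0 | h0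
      · exact ⟨e - 1, by linarith, le_rfl, by simp [h0]⟩
      · have h0' : (0 : ℝ) < b 0 := by exact_mod_cast h0
        refine ⟨min (b 1 / b 0) (e - 1), lt_min ?_ (by linarith), min_le_right _ _, ?_⟩
        · rw [one_lt_div h0']
          exact_mod_cast hb
        · exact (mul_le_mul_of_nonneg_right (min_le_left _ _) h0'.le).trans_eq
            (div_mul_cancel₀ _ h0'.ne')
    obtain ⟨A, hA1, hAe, hA0⟩ := hA
    have hstep : ∀ i, A * b i ≤ b (i + 1) := by
      intro i
      induction i with
      | zero => exact hA0
      | succ i ih =>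
        have h1 := hrec i
        have h5 : (0 : ℝ) ≤ b i := Nat.cast_nonneg _
        have h6 : (0 : ℝ) ≤ b (i + 1) := Nat.cast_nonneg _
        have h7 : A * (A * b (i + 1)) ≤ A * b (i + 1 + 1) := by
          have h8 : (A * e - (e - 1) - A * A) * b (i + 1) ≥ 0 := by
            refine mul_nonneg ?_ h6
            nlinarith
          have h9 : ((e : ℝ) - 1) * (A * b i) ≤ (e - 1) * b (i + 1) :=
            mul_le_mul_of_nonneg_left ih (by linarith)
          have h10 : A * ((e : ℝ) * b (i + 1)) ≤ A * (b (i + 2) + (e - 1) * b i) :=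
            mul_le_mul_of_nonneg_left h1 (by linarith)
          have : (b (i + 1 + 1) : ℝ) = b (i + 2) := rfl
          rw [this]
          nlinarith
        exact le_of_mul_le_mul_left h7 (by linarith)
    refine ⟨?_, A, hA1, Eventually.of_forall hstep⟩
    have hlt : ∀ i, 0 < b (i + 1) → b (i + 1) < b (i + 2) := by
      intro i hi
      have h1 : (0 : ℝ) < b (i + 1) := by exact_mod_cast hi
      have h2 := hstep (i + 1)
      have : (b (i + 1) : ℝ) < b (i + 2) := by
        have : (b (i + 1 + 1) : ℝ) = b (i + 2) := rfl
        nlinarith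
      exact_mod_cast this
    have hbp : ∀ i, 0 < b (i + 1) := by
      intro i
      induction i with
      | zero => exact hpos
      | succ i ih => exact ih.trans (hlt i ih)
    refine strictMono_nat_of_lt_succ fun i => ?_
    cases i with
    | zero => exact hb
    | succ i => exact hlt i (hbp i)

end SyzygyRelations

namespace SyzygyRelations

variable {e : ℕ} {b s : ℕ → ℕ} (h : SyzygyRelations e e e b s)

include h

theorem le_succ (he : 0 < e) (i : ℕ) : b (i + 1) ≤ b (i + 2) := by
  have h1 := (Nat.le_add_right _ _).trans (h.ratio_bound he le_rfl i)
  rw [Nat.sub_self, mul_zero, zero_add] at h1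
  exact Nat.le_of_mul_le_mul_left h1 he

/-- At a repetition of Betti numbers, `𝔪 M_i` has maximal length. -/
theorem eq_of_le (he : 2 ≤ e) (i : ℕ) (hi : b (i + 2) ≤ b (i + 1)) :
    s (i + 2) = e * b (i + 1) ∧ b (i + 2) = b (i + 1) := by
  have heq := le_antisymm hi (h.le_succ (by omega) i)
  have h1 := h.ratio_bound (by omega) le_rfl i
  have h2 : s (i + 2) ≤ b (i + 1) * e := h.le_mul (i + 1)
  rw [Nat.sub_self, mul_zero, zero_add, heq] at h1
  have h3 : (e - 1) * (b (i + 1) * e - s (i + 2)) = 0 := by omega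
  rcases Nat.mul_eq_zero.1 h3 with h4 | h4
  · omega
  · exact ⟨by rw [mul_comm e]; omega, heq⟩

end SyzygyRelations

end Growth

/-! ### Betti numbers of `k` and repeated Betti numbers -/

section Main

variable {R : Type u} [CommRing R] [IsLocalRing R] [IsNoetherianRing R]

namespace MinimalFreeResolution

variable {M : Type u} [AddCommGroup M] [Module R M]

theorem syzygyRelations [IsArtinianRing R] (F : MinimalFreeResolution R M)
    (h3 : maximalIdeal R ^ 3 = ⊥) :
    SyzygyRelations (len R (maximalIdeal R ^ 2 : Ideal R)) (embDim R) (len R (socle R))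
      F.rank F.syzygyRadLen where
  sum_eq i := by rw [F.rank_add_radLen, len_maximalIdeal]
  le_mul i := F.syzygyRadLen_succ_le i
  socle i := F.socle_inequality h3 i

theorem rank_residueField_lt [IsArtinianRing R] (G : MinimalFreeResolution R (ResidueField R))
    (h3 : maximalIdeal R ^ 3 = ⊥) (ha : len R (maximalIdeal R ^ 2 : Ideal R) = embDim R)
    (hr : len R (socle R) = embDim R) (he : 2 ≤ embDim R) (n : ℕ) :
    G.rank n < G.rank (n + 1) := by
  have hrel := G.syzygyRelations h3
  rw [ha, hr] at hrel
  obtain ⟨h0, hs0⟩ := G.rank_zero_residueField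
  have h1 : G.rank 1 = embDim R := G.rank_one_residueField
  rcases Nat.lt_or_ge (embDim R) 4 with h4 | h4
  · have hs := G.syzygyRadLen_two_lt h3 (by omega) ha
    rw [ha] at hs
    induction n using Nat.strong_induction_on with
    | _ n ih =>
      by_contra hlt
      rw [not_lt] at hlt
      match n, ih, hlt with
      | 0, _, hlt =>
        change G.rank 1 ≤ G.rank 0 at hlt
        omega
      | 1, _, hlt =>
        have := (hrel.eq_of_le he 0 hlt).1
        rw [mul_comm] at this
        exact hs.ne this
      -- `k` is a summand of its own second syzygy, so a failure at `n + 2` descends to a failure at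
      -- `n`.
      | n + 2, ih, hlt =>
        obtain ⟨e1, e2⟩ := hrel.eq_of_le he (n + 1) hlt
        have hsum := G.residueSummand_of_lt h3 0 (by rwa [ha])
        have key := G.syzygyRadLen_eq_of_summand G h3 2 n hsum (by
          rw [show 2 + (n + 1) = n + 1 + 2 by ring, e1, e2])
        have hu := hrel.le_mul n
        rw [key, mul_comm] at hu
        exact (ih n (by omega)).not_ge (Nat.le_of_mul_le_mul_right hu (by omega))
  -- For `e ≥ 4` doubling propagates: `b (n+2) ≥ e (b (n+1) - b n) ≥ (e/2) b (n+1)`.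
  · have h2 : ∀ n, 0 < G.rank n ∧ 2 * G.rank n ≤ G.rank (n + 1) := by
      intro n
      induction n with
      | zero => rw [h0, h1]; omega
      | succ n ih =>
        have hl := hrel.linear_bound n
        refine ⟨by omega, ?_⟩
        have : embDim R * (2 * G.rank n) ≤ embDim R * G.rank (n + 1) :=
          Nat.mul_le_mul_left _ ih.2
        have h5 : 4 * G.rank (n + 1) ≤ embDim R * G.rank (n + 1) := Nat.mul_le_mul_right _ h4
        change 2 * G.rank (n + 1) ≤ G.rank (n + 2)
        have h6 : embDim R * (2 * G.rank n) = 2 * (embDim R * G.rank n) := by ring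
        omega
    have := h2 n
    omega

theorem residueSummand_of_rank_eq [IsArtinianRing R] [Module.Finite R M]
    (F : MinimalFreeResolution R M)
    (h3 : maximalIdeal R ^ 3 = ⊥) (ha : len R (maximalIdeal R ^ 2 : Ideal R) = embDim R)
    (hr : len R (socle R) = embDim R) (he : 2 ≤ embDim R) (hM : F.rank 0 < F.rank 1) (j : ℕ)
    (hj : F.rank (j + 2) ≤ F.rank (j + 1)) :
    F.ResidueSummandOfSyzygy (j + 3) ∧ ∀ i ≤ j + 2, ¬ F.ResidueSummandOfSyzygy i := by
  have hrel := F.syzygyRelations h3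
  rw [ha, hr] at hrel
  obtain ⟨e1, e2⟩ := hrel.eq_of_le he j hj
  have hpos : ∀ i, 0 < F.rank (i + 1) := by
    intro i
    induction i with
    | zero => exact hM.trans_le' (Nat.zero_le _)
    | succ i ih => exact ih.trans_le (hrel.le_succ (by omega) i)
  constructor
  · refine F.residueSummand_of_lt h3 (j + 1) ?_
    have h1 := hrel.sum_eq (j + 2)
    have h2 := hpos (j + 2)
    rw [e1, mul_add, ← e2, mul_comm (embDim R)] at h1
    rw [ha]
    change F.syzygyRadLen (j + 2 + 1) < F.rank (j + 2) * embDim R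
    omega
  · intro i hi hsum
    obtain ⟨G⟩ := nonempty_minimalFreeResolution (R := R) (ResidueField R)
    rcases hi.eq_or_lt with rfl | hi
    · have := F.syzygyRadLen_lt_of_summand h3 (by omega) (j + 1) hsum
      change F.syzygyRadLen (j + 2) < embDim R * F.rank (j + 2) at this
      rw [e1, e2] at this
      exact lt_irrefl _ this
    -- Extremality passes to `k`: `e β_{n+1}(k) = s (n+1) ≤ e β_n(k)`, against strict growth.
    · obtain ⟨n, hn⟩ := Nat.exists_eq_add_of_lt hi
      have key := F.syzygyRadLen_eq_of_summand G h3 i n hsum (by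
        rw [show i + (n + 1) = j + 2 by omega, e1, e2])
      have hrelG := G.syzygyRelations h3
      rw [ha, hr] at hrelG
      have hu := hrelG.le_mul n
      rw [key, mul_comm] at hu
      exact (G.rank_residueField_lt h3 ha hr he n).not_ge
        (Nat.le_of_mul_le_mul_right hu (by omega))

end MinimalFreeResolution

end Main

end LocalRingBetti

theorem mainTheorem5 (R : Type u) [CommRing R] [IsLocalRing R] [IsNoetherianRing R]
    (h3 : IsLocalRing.maximalIdeal R ^ 3 = ⊥) (h2 : IsLocalRing.maximalIdeal R ^ 2 ≠ ⊥)
    (hG : ¬ LocalRingBetti.IsGorensteinLocal R)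
    (M : Type u) [AddCommGroup M] [Module R M] [Module.Finite R M]
    (hM : LocalRingBetti.betti R M 0 < LocalRingBetti.betti R M 1)
    (a e r : ℕ)
    (ha : a = LocalRingBetti.residueRank (LocalRingBetti.isTorsionBySet_sq h3))
    (he : e = LocalRingBetti.embDim R)
    (hr : r = LocalRingBetti.socleRank R) :
    ((a ≠ e ∨ a ≠ r) →
      StrictMono (LocalRingBetti.betti R M) ∧
        LocalRingBetti.TermwiseExponentialGrowth (LocalRingBetti.betti R M)) ∧
    ((a = e ∧ e = r) →
      Monotone (LocalRingBetti.betti R M) ∧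
      {i : ℕ | 1 ≤ i ∧ ¬ LocalRingBetti.betti R M (i - 1) <
        LocalRingBetti.betti R M i}.Subsingleton ∧
      ∀ j : ℕ, 1 ≤ j → LocalRingBetti.betti R M j = LocalRingBetti.betti R M (j - 1) →
        2 ≤ j ∧
        ∀ F : LocalRingBetti.MinimalFreeResolution R M,
          F.ResidueSummandOfSyzygy (j + 1) ∧
          ∀ i : ℕ, i ≤ j → ¬ F.ResidueSummandOfSyzygy i) := by
  open LocalRingBetti in
  have hart : IsArtinianRing R := isArtinianRing_of_pow_eq_bot h3
  rw [residueRank_eq_len] at ha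
  rw [socleRank_eq_len] at hr
  have hrank : ∀ F : MinimalFreeResolution R M, F.rank = betti R M := fun F =>
    funext F.rank_eq_betti
  obtain ⟨F₀⟩ := nonempty_minimalFreeResolution (R := R) M
  have hrel := F₀.syzygyRelations h3
  rw [hrank, ← ha, ← he, ← hr] at hrel
  have hr2 : 2 ≤ r := by
    by_contra h
    exact hG (isGorensteinLocal_of_len_socle_le_one (by omega))
  have ha0 : 0 < a := by
    have : Nontrivial (maximalIdeal R ^ 2 : Ideal R) := Submodule.nontrivial_iff_ne_bot.2 h2
    exact ha ▸ len_pos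
  have har : a ≤ r := ha ▸ hr ▸ len_submodule_mono (sq_le_socle h3)
  have he0 : 0 < e := he ▸ embDim_pos h3 h2
  refine ⟨hrel.growth he0 ha0 har hr2 hM, ?_⟩
  rintro ⟨rfl, rfl⟩
  have hkey : ∀ (F : MinimalFreeResolution R M) (j : ℕ), betti R M (j + 2) ≤ betti R M (j + 1) →
      F.ResidueSummandOfSyzygy (j + 3) ∧ ∀ i ≤ j + 2, ¬ F.ResidueSummandOfSyzygy i := by
    intro F j hj
    rw [← hrank F] at hj hM
    exact F.residueSummand_of_rank_eq h3 (by omega) (by omega) (by omega) hM j hj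
  have hshape : ∀ j, 1 ≤ j → ¬ betti R M (j - 1) < betti R M j →
      ∃ i, j = i + 2 ∧ betti R M (i + 2) ≤ betti R M (i + 1) := by
    intro j hj hnot
    match j, hj with
    | 1, _ => exact absurd hM hnot
    | i + 2, _ => exact ⟨i, rfl, not_lt.1 hnot⟩
  refine ⟨monotone_nat_of_le_succ fun i => ?_, ?_, ?_⟩
  · cases i with
    | zero => exact hM.le
    | succ i => exact hrel.le_succ he0 i
  -- The repetition at `i + 2` splits `k` off syzygy `i + 3 ≤ j + 2`, which the repetition at `j +
  -- 2` forbids.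
  · have huniq : ∀ i j, i < j → betti R M (i + 2) ≤ betti R M (i + 1) →
        betti R M (j + 2) ≤ betti R M (j + 1) → False := fun i j hij hi hj =>
      (hkey F₀ j hj).2 (i + 3) (by omega) (hkey F₀ i hi).1
    rintro _ ⟨h1, h1'⟩ _ ⟨h2, h2'⟩
    obtain ⟨i, rfl, hi⟩ := hshape _ h1 h1'
    obtain ⟨j, rfl, hj⟩ := hshape _ h2 h2'
    rcases lt_trichotomy i j with hij | rfl | hij
    · exact (huniq i j hij hi hj).elim
    · rfl
    · exact (huniq j i hij hj hi).elim
  · intro j hj heq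
    obtain ⟨i, rfl, hi⟩ := hshape j hj (by rw [heq]; exact lt_irrefl _)
    exact ⟨by omega, fun F => hkey F i hi⟩
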